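/- Consider problems $\min \sum_{i=1}^n f_i(x_i)$ subject to $\sum_{i=1}^n(\mathbf A_i x_i-b_i)=0$, where $x_i\in\mathbb R^{d_i}$, $\mathbf A_i\in\mathbb R^{m\times d_i}$, $b_i\in\mathbb R^m$ and the data with index $i$ are held by node $i$ of a communication graph $\mathcal G=(\mathcal V,\mathcal E)$ on $n$ nodes. Write $\kappa_f=L_f/\mu_f$ and $\kappa_{\mathbf A}=L_{\mathbf A}/\mu_{\mathbf A}$ with $L_{\mathbf A}=\max_i\sigma_{\max}^2(\mathbf A_i)$, $\mu_{\mathbf A}=\lambda_{\min}^+\bigl(\frac1n\sum_i\mathbf A_i\mathbf A_i^\top\bigr)$. A gossip matrix of $\mathcal G$ is a symmetric positive semidefinite $W\in\mathbb R^{n\times n}$ with $W_{ij}\ne0$ iff $(i,j)\in\mathcal E$ or $i=j$, and with $Wy=0$ iff $y_1=\dots=y_n$; $\kappa_{\mathbf W}=\lambda_{\max}(W)/\lambda_{\min}^+(W)$. A first-order decentralized algorithm keeps at node $i$ linear subspaces $\mathcal M_i(k)\subseteq\mathbb R^{d_i}$ (private memory) and $\mathcal H_i(k)\subseteq\mathbb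 R^m$ (shared memory), with $\mathcal M_i(0)=\mathcal H_i(0)=\{0\}$, and at each step $k$ performs, at all nodes, a round of one of three types; a node may keep or discard what it holds. (1) Gradient round: $\mathcal M_i(k+1)\subseteq\operatorname{span}\{x,\nabla f_i(x),\nabla f_i^*(x):x\in\mathcal M_i(k)\}$, where $f_i^*$ is the Fenchel conjugate, and $\mathcal H_i(k+1)\subseteq\mathcal H_i(k)$. (2) Matrix multiplication round: $\mathcal M_i(k+1)\subseteq\mathcal M_i(k)+\operatorname{span}\{\mathbf A_i^\top b_i,\mathbf A_i^\top y:y\in\mathcal H_i(k)\}$ and $\mathcal H_i(k+1)\subseteq\mathcal H_i(k)+\operatorname{span}\{b_i,\mathbf A_ix:x\in\mathcal M_i(k)\}$. (3) Communication round: $\mathcal M_i(k+1)\subseteq\mathcal M_i(k)$ and $\mathcal H_i(k+1)\subseteq\mathcal H_i(k)+\operatorname{span}\bigcup_{(i,j)\in\mathcal E}\mathcal H_j(k)$. It has reached accuracy $\varepsilon$ at step $k$ if there are $x_i\in\mathcal M_i(k)$ with $\sum_i\|x_i-x_i^*\|^2\le\varepsilon$, where $x^*$ is the solution. **Theorem.**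 For every $\kappa_0>1$ there is a constant $c>0$ such that for all $L_f>\mu_f>0$ with $\kappa_f\ge\kappa_0$ and all $\kappa_{\mathbf A}\ge1$, $\kappa_{\mathbf W}\ge1$ the following holds. (a) There are $n$, a graph $\mathcal G$ with a gossip matrix $W$ of condition number exactly $\kappa_{\mathbf W}$, and $\varepsilon_{\max}>0$ such that for every $\varepsilon_{\min}>0$ there are dimensions $m,d_1,\dots,d_n$, continuously differentiable $L_f$-smooth $\mu_f$-strongly convex functions $f_i$, matrices $\mathbf A_i$ of condition number exactly $\kappa_{\mathbf A}$ and vectors $b_i$, with solution $x^*$ satisfying $\sum_i\|x_i^*\|^2=1$, for which every first-order decentralized algorithm that reaches an accuracy $\varepsilon\in[\varepsilon_{\min},\varepsilon_{\max}]$ has used by then at least $$N_{\mathbf A}\ge c\sqrt{\kappa_f}\sqrt{\kappa_{\mathbf A}}\log\tfrac1\varepsilon\ \text{ matrix multiplication rounds and }\ N_{\mathbf W}\ge c\sqrt{\kappa_f}\sqrt{\kappa_{\mathbf A}}\sqrt{\kappa_{\mathbf W}}\log\tfrac1\varepsilon\ \text{ communication rounds.}$$ (b) There are, with the same order of choices and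 the same requirements, another graph with gossip matrix, another threshold $\varepsilon_{\max}$ and other functions, matrices and vectors, for which every first-order decentralized algorithm that reaches an accuracy $\varepsilon\in[\varepsilon_{\min},\varepsilon_{\max}]$ has used by then at least $N_f\ge c\sqrt{\kappa_f}\log\frac1\varepsilon$ gradient rounds. -/

import Mathlib

noncomputable section

/-! Spectral quantities of square real matrices. -/

/-- `t` is the largest eigenvalue of the square matrix `C`. -/
def IsMaxEigenvalue {n : ℕ} (C : Matrix (Fin n) (Fin n) ℝ) (t : ℝ) : Prop :=
  IsGreatest {s : ℝ | Module.End.HasEigenvalue (Matrix.toLin' C) s} t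

/-- `t` is the smallest positive eigenvalue of the square matrix `C`. -/
def IsMinPosEigenvalue {n : ℕ} (C : Matrix (Fin n) (Fin n) ℝ) (t : ℝ) : Prop :=
  IsLeast {s : ℝ | 0 < s ∧ Module.End.HasEigenvalue (Matrix.toLin' C) s} t

/-! Gossip matrices. -/

/-- `W` is a gossip matrix of the communication graph `G`. -/
structure IsGossipMatrix {n : ℕ} (G : SimpleGraph (Fin n))
    (W : Matrix (Fin n) (Fin n) ℝ) : Prop where
  posSemidef : W.PosSemidef
  support : ∀ i j, W i j ≠ 0 ↔ (G.Adj i j ∨ i = j)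
  kernel : ∀ y : Fin n → ℝ, W.mulVec y = 0 ↔ ∀ i j, y i = y j

/-- The condition number of a gossip matrix, `λ_max(W) / λ_min⁺(W)`, is `κ`. -/
def GossipConditionNumber {n : ℕ} (W : Matrix (Fin n) (Fin n) ℝ) (κ : ℝ) : Prop :=
  ∃ a b : ℝ, IsMaxEigenvalue W a ∧ IsMinPosEigenvalue W b ∧ κ = a / b

/-! Functions. -/

/-- Continuously differentiable, `μ`-strongly convex and `L`-smooth functions on `ℝ^d`. -/
def SmoothStronglyConvex {d : ℕ} (μ L : ℝ) (f : EuclideanSpace ℝ (Fin d) → ℝ) : Prop :=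
  ContDiff ℝ 1 f ∧ ∀ x₁ x₂ : EuclideanSpace ℝ (Fin d),
    μ / 2 * ‖x₂ - x₁‖ ^ 2 ≤ f x₂ - f x₁ - inner ℝ (gradient f x₁) (x₂ - x₁) ∧
    f x₂ - f x₁ - inner ℝ (gradient f x₁) (x₂ - x₁) ≤ L / 2 * ‖x₂ - x₁‖ ^ 2

/-- The Fenchel conjugate `f*(y) = sup_x (⟨y, x⟩ - f x)`; the supremum is finite for the
strongly convex functions to which it is applied. -/
def fenchelConjugate {d : ℕ} (f : EuclideanSpace ℝ (Fin d) → ℝ)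
    (y : EuclideanSpace ℝ (Fin d)) : ℝ :=
  ⨆ x : EuclideanSpace ℝ (Fin d), (inner ℝ y x - f x)

/-! The optimization problem. -/

/-- The data of the problem `min ∑ᵢ fᵢ(xᵢ)` subject to `∑ᵢ (Aᵢ xᵢ - bᵢ) = 0`, where `xᵢ ∈ ℝ^{dᵢ}`
is held by node `i` and the constraint takes values in `ℝ^m`. -/
structure CoupledProblem (n : ℕ) where
  m : ℕ
  d : Fin n → ℕ
  f : ∀ i, EuclideanSpace ℝ (Fin (d i)) → ℝ
  A : ∀ i, Matrix (Fin m) (Fin (d i)) ℝ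
  b : Fin n → EuclideanSpace ℝ (Fin m)

namespace CoupledProblem

variable {n : ℕ} (P : CoupledProblem n)

/-- A point of `ℝ^{d₁} × ⋯ × ℝ^{dₙ}`. -/
abbrev Point : Type := ∀ i, EuclideanSpace ℝ (Fin (P.d i))

/-- The coupled affine constraint. -/
def Feasible (x : P.Point) : Prop :=
  ∑ i, (Matrix.toEuclideanLin (P.A i) (x i) - P.b i) = 0

/-- `x` solves the problem. -/
def IsSolution (x : P.Point) : Prop :=
  P.Feasible x ∧ ∀ y : P.Point, P.Feasible y → ∑ i, P.f i (x i) ≤ ∑ i, P.f i (y i)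

/-- The matrix `S = (1/n) ∑ᵢ Aᵢ Aᵢᵀ`. -/
def S : Matrix (Fin P.m) (Fin P.m) ℝ :=
  (1 / (n : ℝ)) • ∑ i, P.A i * (P.A i).transpose

/-- `κ = L_A / μ_A`, where `L_A = maxᵢ σ_max²(Aᵢ)` (the largest eigenvalue of some `Aᵢ Aᵢᵀ`)
and `μ_A = λ_min⁺(S)`. -/
def ConstraintConditionNumber (κ : ℝ) : Prop :=
  ∃ LA μA : ℝ,
    IsGreatest {s : ℝ | ∃ i, Module.End.HasEigenvalue
      (Matrix.toLin' (P.A i * (P.A i).transpose)) s} LA ∧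
    IsMinPosEigenvalue P.S μA ∧ κ = LA / μA

end CoupledProblem

/-! First-order decentralized algorithms. -/

/-- The three types of synchronized rounds: local gradient computations, local multiplications by
`Aᵢ` and `Aᵢᵀ`, communication with the neighbors. -/
inductive Round where
  | gradient
  | multiplication
  | communication

/-- An execution of a first-order decentralized algorithm on the problem `P` over the graph `G`.
At step `k` node `i` has the private memory `M k i ⊆ ℝ^{dᵢ}` and the shared memory `H k i ⊆ ℝ^m`,
and `round k` is the round chosen at this step. The initial memories are trivial. A node may keep
what it has in memory, and it may also discard it (hence inclusions). -/
structure Execution {n : ℕ} (P : CoupledProblem n) (G : SimpleGraph (Fin n)) where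
  round : ℕ → Round
  M : ℕ → ∀ i : Fin n, Submodule ℝ (EuclideanSpace ℝ (Fin (P.d i)))
  H : ℕ → Fin n → Submodule ℝ (EuclideanSpace ℝ (Fin P.m))
  M_zero : ∀ i, M 0 i = ⊥
  H_zero : ∀ i, H 0 i = ⊥
  gradient_M : ∀ k, round k = Round.gradient → ∀ i,
    M (k + 1) i ≤ Submodule.span ℝ
      {v | ∃ x ∈ M k i, v = x ∨ v = gradient (P.f i) x ∨
        v = gradient (fenchelConjugate (P.f i)) x}
  gradient_H : ∀ k, round k = Round.gradient → ∀ i, H (k + 1) i ≤ H k i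
  multiplication_M : ∀ k, round k = Round.multiplication → ∀ i,
    M (k + 1) i ≤ M k i ⊔ Submodule.span ℝ
      {v | v = Matrix.toEuclideanLin (P.A i).transpose (P.b i) ∨
        ∃ y ∈ H k i, v = Matrix.toEuclideanLin (P.A i).transpose y}
  multiplication_H : ∀ k, round k = Round.multiplication → ∀ i,
    H (k + 1) i ≤ H k i ⊔ Submodule.span ℝ
      {v | v = P.b i ∨ ∃ x ∈ M k i, v = Matrix.toEuclideanLin (P.A i) x}
  communication_M : ∀ k, round k = Round.communication → ∀ i, M (k + 1) i ≤ M k i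
  communication_H : ∀ k, round k = Round.communication → ∀ i,
    H (k + 1) i ≤ H k i ⊔ Submodule.span ℝ {v | ∃ j, G.Adj i j ∧ v ∈ H k j}

namespace Execution

variable {n : ℕ} {P : CoupledProblem n} {G : SimpleGraph (Fin n)}

/-- The number of rounds of type `r` among the first `k` steps. -/
def count (E : Execution P G) (r : Round) (k : ℕ) : ℕ :=
  {t : ℕ | t < k ∧ E.round t = r}.ncard

/-- After `k` steps the nodes hold in their memories a point within accuracy `ε` of `xs`:
`‖x - xs‖² ≤ ε`. -/
def Reaches (E : Execution P G) (xs : P.Point) (ε : ℝ) (k : ℕ) : Prop :=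
  ∃ x : P.Point, (∀ i, x i ∈ E.M k i) ∧ ∑ i, ‖x i - xs i‖ ^ 2 ≤ ε

end Execution

/-- Every first-order decentralized algorithm that reaches accuracy `ε` on the problem `P` over the
graph `G` has used at least `N` rounds of type `r`. -/
def RequiresRounds {n : ℕ} (P : CoupledProblem n) (G : SimpleGraph (Fin n)) (xs : P.Point)
    (ε : ℝ) (r : Round) (N : ℝ) : Prop :=
  ∀ (E : Execution P G) (k : ℕ), E.Reaches xs ε k → N ≤ (E.count r k : ℝ)

/-- The problem `P` has `L`-smooth `μ`-strongly convex functions, its matrices have condition number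
`κA`, and `xs` is its solution, at distance one from the starting point `0`. -/
structure IsInstance {n : ℕ} (P : CoupledProblem n) (xs : P.Point) (L μ κA : ℝ) : Prop where
  functions : ∀ i, SmoothStronglyConvex μ L (P.f i)
  matrices : P.ConstraintConditionNumber κA
  solution : P.IsSolution xs
  normalized : ∑ i, ‖xs i‖ ^ 2 = 1

end

/-!
The hard instances are the classical chain of coordinates for strongly convex
minimization, split between two groups `B` and `C` of nodes at distance `D` in the graph. The nodes
of `B` couple the coordinates `(1, 2), (3, 4), …`, those of `C` couple `(0, 1), (2, 3), …`, the other
nodes couple nothing, and only `B` knows a right-hand side, which is supported on the coordinate `0`.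
Writing `Πᵢ` for the projection `x ↦ (x - x ∘ τᵢ) / 2` of the involution `τᵢ` of the coordinates that
the node `i` couples, `fᵢ` has the Hessian `L - (L - μ) Πᵢ` and `Aᵢ` is the symmetric matrix
`1 + (s - 1) Πᵢ` (`pairedProblem`), with `s = √κ_A` to count
multiplications and communications, and `s = 1` to count gradient computations. One further
coordinate, on which every `Aᵢ` is `√κ_A`, and one on which every `Aᵢ` is `1` make the condition
number equal to `κ_A` (`constraintConditionNumber_pairedProblem`); they play no role otherwise.

The dual Hessian `∑ᵢ Aᵢ (∇²fᵢ)⁻¹ Aᵢᵀ` is a multiple of `3 + (s² κ_f - 1) Δ / 2`, with `Δ` the Laplacian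
of the chain, so that the multiplier is the geometric sequence of the ratio `q` with
`(1 - q)² = 6 q / (s² κ_f - 1)`, reflected at the end of the chain (`reflectedGeom`). A node outside
the groups has a multiple of it as its part of the solution. Hence a point that vanishes at the
coordinate `p` has error at least `K q ^ (2 p)` with `K` independent of the length of the chain
(`exists_chain_instance`), and `-log q` is at most of order `1 / (s √κ_f)`.

It remains to see how slowly the memories spread along the chain (`Execution.memory_le`). To learn
one more coordinate, information has to cross from one group to the other: this takes `D`
communication rounds (`memory_communication`) and a multiplication round, since shared and private
memory interact only there (`memory_multiplication`). If `s = 1`, the matrices are diagonal and only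
gradient rounds couple coordinates (`memory_gradient`).

For the gossip matrix, each vertex of a path with `3 M` vertices, or of a triangle if `κ_W` is small,
is doubled. On vectors that are symmetric under the exchange of the copies the matrix is the
Laplacian, whose nonzero spectrum is only estimated; on the antisymmetric ones it is diagonal with
entries that can be prescribed and that realize the extreme eigenvalues, so that the condition number
is exactly `κ_W` while `D` is of order `√κ_W` (`exists_separatedNetwork`).
-/

noncomputable section

/-! ### Half-differences along an involution -/

/-- Half the difference of a vector and its image under a permutation `τ` of the coordinates:
`(x_j - x_{τ j}) / 2`. For an involution `τ` this is the orthogonal projection onto the vectors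
that `τ` maps to their negatives. -/
def halfDiff {d : ℕ} (τ : Fin d → Fin d) :
    EuclideanSpace ℝ (Fin d) →ₗ[ℝ] EuclideanSpace ℝ (Fin d) where
  toFun x := WithLp.toLp 2 fun j => (x j - x (τ j)) / 2
  map_add' x y := by ext j; simp; ring
  map_smul' r x := by ext j; simp; ring

@[simp] lemma halfDiff_apply {d : ℕ} (τ : Fin d → Fin d) (x : EuclideanSpace ℝ (Fin d))
    (j : Fin d) : halfDiff τ x j = (x j - x (τ j)) / 2 := rfl

lemma halfDiff_idem {d : ℕ} {τ : Fin d → Fin d} (hτ : Function.Involutive τ)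
    (x : EuclideanSpace ℝ (Fin d)) : halfDiff τ (halfDiff τ x) = halfDiff τ x := by
  ext j; simp [hτ j]; ring

lemma inner_halfDiff_left {d : ℕ} {τ : Fin d → Fin d} (hτ : Function.Involutive τ)
    (x y : EuclideanSpace ℝ (Fin d)) :
    inner ℝ (halfDiff τ x) y = inner ℝ x (halfDiff τ y) := by
  have h : ∑ j, y j * x (τ j) = ∑ j, y (τ j) * x j := by
    rw [← Equiv.sum_comp hτ.toPerm]
    simp [hτ _]
  simp only [PiLp.inner_apply, halfDiff_apply, RCLike.inner_apply, conj_trivial]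
  have e1 : ∀ j, y j * ((x j - x (τ j)) / 2) = y j * x j / 2 - y j * x (τ j) / 2 := by
    intro j; ring
  have e2 : ∀ j, (y j - y (τ j)) / 2 * x j = y j * x j / 2 - y (τ j) * x j / 2 := by
    intro j; ring
  simp only [e1, e2, Finset.sum_sub_distrib, ← Finset.sum_div, h]

lemma inner_halfDiff_halfDiff {d : ℕ} {τ : Fin d → Fin d} (hτ : Function.Involutive τ)
    (x y : EuclideanSpace ℝ (Fin d)) :
    inner ℝ (halfDiff τ x) (halfDiff τ y) = inner ℝ x (halfDiff τ y) := by
  rw [inner_halfDiff_left hτ, halfDiff_idem hτ]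

lemma inner_self_halfDiff {d : ℕ} {τ : Fin d → Fin d} (hτ : Function.Involutive τ)
    (x : EuclideanSpace ℝ (Fin d)) : inner ℝ x (halfDiff τ x) = ‖halfDiff τ x‖ ^ 2 := by
  rw [← real_inner_self_eq_norm_sq, inner_halfDiff_halfDiff hτ]

lemma norm_halfDiff_sq_le {d : ℕ} {τ : Fin d → Fin d} (hτ : Function.Involutive τ)
    (x : EuclideanSpace ℝ (Fin d)) : ‖halfDiff τ x‖ ^ 2 ≤ ‖x‖ ^ 2 := by
  have h := norm_sub_sq_real x (halfDiff τ x)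
  rw [inner_self_halfDiff hτ] at h
  nlinarith [sq_nonneg ‖x - halfDiff τ x‖]

/-! ### The local functions and their conjugates -/

/-- The quadratic form `a/2 ‖x‖² + b/2 ‖Πx‖²`, where `Π` is `halfDiff τ`; its Hessian is
`a + b Π`. -/
def pairQuad {d : ℕ} (τ : Fin d → Fin d) (a b : ℝ) (x : EuclideanSpace ℝ (Fin d)) : ℝ :=
  a / 2 * ‖x‖ ^ 2 + b / 2 * ‖halfDiff τ x‖ ^ 2

lemma pairQuad_eq {d : ℕ} {τ : Fin d → Fin d} (hτ : Function.Involutive τ) (a b : ℝ)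
    (x y : EuclideanSpace ℝ (Fin d)) :
    pairQuad τ a b y - pairQuad τ a b x - inner ℝ (a • x + b • halfDiff τ x) (y - x) =
      pairQuad τ a b (y - x) := by
  simp only [pairQuad, map_sub, inner_add_left, inner_smul_left, inner_sub_right,
    norm_sub_sq_real, real_inner_self_eq_norm_sq, conj_trivial]
  rw [inner_halfDiff_left hτ x x, inner_self_halfDiff hτ,
    inner_halfDiff_left hτ x y, inner_halfDiff_halfDiff hτ y x, real_inner_comm x y,
    ← inner_halfDiff_left hτ y x, real_inner_comm x (halfDiff τ y)]
  ring

lemma hasGradientAt_pairQuad {d : ℕ} {τ : Fin d → Fin d} (hτ : Function.Involutive τ) (a b : ℝ)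
    (x : EuclideanSpace ℝ (Fin d)) :
    HasGradientAt (pairQuad τ a b) (a • x + b • halfDiff τ x) x := by
  have h1 : HasFDerivAt (fun x : EuclideanSpace ℝ (Fin d) => ‖x‖ ^ 2) (2 • innerSL ℝ x) x :=
    (hasStrictFDerivAt_norm_sq x).hasFDerivAt
  have h2 := ((hasStrictFDerivAt_norm_sq (halfDiff τ x)).hasFDerivAt).comp x
    (LinearMap.toContinuousLinearMap (halfDiff τ)).hasFDerivAt
  have h3 := (h1.const_mul (a / 2)).add (h2.const_mul (b / 2))
  rw [hasGradientAt_iff_hasFDerivAt]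
  refine h3.congr_fderiv ?_
  ext y
  simp [inner_halfDiff_halfDiff hτ]
  rw [inner_halfDiff_left hτ]
  ring

lemma gradient_pairQuad {d : ℕ} {τ : Fin d → Fin d} (hτ : Function.Involutive τ) (a b : ℝ)
    (x : EuclideanSpace ℝ (Fin d)) :
    gradient (pairQuad τ a b) x = a • x + b • halfDiff τ x :=
  (hasGradientAt_pairQuad hτ a b x).gradient

lemma contDiff_pairQuad {d : ℕ} (τ : Fin d → Fin d) (a b : ℝ) :
    ContDiff ℝ 1 (pairQuad τ a b) := by
  have h := (LinearMap.toContinuousLinearMap (halfDiff τ)).contDiff (n := 1)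
  exact (contDiff_const.mul (contDiff_norm_sq ℝ)).add (contDiff_const.mul (h.norm_sq ℝ))

lemma pairQuad_le {d : ℕ} (τ : Fin d → Fin d) {a b : ℝ} (hb : b ≤ 0)
    (x : EuclideanSpace ℝ (Fin d)) : pairQuad τ a b x ≤ a / 2 * ‖x‖ ^ 2 := by
  have := mul_nonneg (neg_nonneg.2 hb) (sq_nonneg ‖halfDiff τ x‖)
  unfold pairQuad
  linarith

lemma le_pairQuad {d : ℕ} {τ : Fin d → Fin d} (hτ : Function.Involutive τ) {a b : ℝ} (hb : b ≤ 0)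
    (x : EuclideanSpace ℝ (Fin d)) : (a + b) / 2 * ‖x‖ ^ 2 ≤ pairQuad τ a b x := by
  have := mul_nonneg (neg_nonneg.2 hb) (sub_nonneg.2 (norm_halfDiff_sq_le hτ x))
  unfold pairQuad
  linarith

lemma smoothStronglyConvex_pairQuad {d : ℕ} {τ : Fin d → Fin d} (hτ : Function.Involutive τ)
    {L μ : ℝ} (h : μ ≤ L) : SmoothStronglyConvex μ L (pairQuad τ L (μ - L)) := by
  refine ⟨contDiff_pairQuad _ _ _, fun x y => ?_⟩
  rw [gradient_pairQuad hτ, pairQuad_eq hτ]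
  refine ⟨?_, pairQuad_le τ (by linarith) _⟩
  have := le_pairQuad hτ (a := L) (b := μ - L) (by linarith) (y - x)
  simpa using this

/-- The conjugate of a form with Hessian `a + b Π` has the inverse Hessian
`a⁻¹ + ((a + b)⁻¹ - a⁻¹) Π`. -/
lemma fenchelConjugate_pairQuad {d : ℕ} {τ : Fin d → Fin d} (hτ : Function.Involutive τ)
    {L μ : ℝ} (hμ : 0 < μ) (h : μ ≤ L) :
    fenchelConjugate (pairQuad τ L (μ - L)) = pairQuad τ (1 / L) (1 / μ - 1 / L) := by
  have hL : 0 < L := hμ.trans_le h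
  funext y
  -- the maximizer in the definition of the conjugate
  set g : EuclideanSpace ℝ (Fin d) := (1 / L) • y + (1 / μ - 1 / L) • halfDiff τ y with hg
  have hinv : L • g + (μ - L) • halfDiff τ g = y := by
    ext j
    simp [hg, hτ j]
    field_simp
    ring
  have hval : inner ℝ y g - pairQuad τ L (μ - L) g = pairQuad τ (1 / L) (1 / μ - 1 / L) y := by
    have e : halfDiff τ g = (1 / μ) • halfDiff τ y := by
      rw [hg, map_add, map_smul, map_smul, halfDiff_idem hτ, ← add_smul]
      congr 1; ring
    have e2 : ‖g‖ ^ 2 = (1 / L) ^ 2 * ‖y‖ ^ 2 + ((1 / μ) ^ 2 - (1 / L) ^ 2) *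
        ‖halfDiff τ y‖ ^ 2 := by
      rw [hg, norm_add_sq_real, norm_smul, norm_smul, inner_smul_left, inner_smul_right,
        inner_self_halfDiff hτ, mul_pow, mul_pow, Real.norm_eq_abs, Real.norm_eq_abs, sq_abs,
        sq_abs, conj_trivial]
      ring
    have e3 : inner ℝ y g = (1 / L) * ‖y‖ ^ 2 + (1 / μ - 1 / L) * ‖halfDiff τ y‖ ^ 2 := by
      rw [hg, inner_add_right, inner_smul_right, inner_smul_right, inner_self_halfDiff hτ,
        real_inner_self_eq_norm_sq]
    unfold pairQuad
    rw [e, e2, e3, norm_smul, mul_pow, Real.norm_eq_abs, sq_abs]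
    field_simp
    ring
  have hle : ∀ x, inner ℝ y x - pairQuad τ L (μ - L) x ≤
      pairQuad τ (1 / L) (1 / μ - 1 / L) y := by
    intro x
    have h1 := pairQuad_eq hτ L (μ - L) g x
    rw [hinv, inner_sub_right] at h1
    have h2 := le_pairQuad hτ (a := L) (b := μ - L) (by linarith) (x - g)
    have h3 : 0 ≤ (L + (μ - L)) / 2 * ‖x - g‖ ^ 2 := by
      have : 0 ≤ L + (μ - L) := by linarith
      positivity
    linarith
  refine le_antisymm (ciSup_le hle) ?_
  rw [← hval]
  exact le_ciSup (f := fun x => inner ℝ y x - pairQuad τ L (μ - L) x)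
    ⟨_, by rintro _ ⟨x, rfl⟩; exact hle x⟩ g

/-! ### The local matrices -/

/-- The operator `x ↦ x + (s - 1) Πx + (t - 1) x_l e_l`, where `Π` is `halfDiff τ`. -/
def pairScale {d : ℕ} (τ : Fin d → Fin d) (s t : ℝ) (l : Fin d) :
    EuclideanSpace ℝ (Fin d) →ₗ[ℝ] EuclideanSpace ℝ (Fin d) where
  toFun x := WithLp.toLp 2 fun j => x j + (s - 1) * halfDiff τ x j +
    if j = l then (t - 1) * x j else 0
  map_add' x y := by ext j; simp; split_ifs <;> ring
  map_smul' r x := by ext j; simp; split_ifs <;> ring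

@[simp] lemma pairScale_apply {d : ℕ} (τ : Fin d → Fin d) (s t : ℝ) (l : Fin d)
    (x : EuclideanSpace ℝ (Fin d)) (j : Fin d) :
    pairScale τ s t l x j = x j + (s - 1) * halfDiff τ x j + if j = l then (t - 1) * x j else 0 :=
  rfl

lemma inner_pairScale_left {d : ℕ} {τ : Fin d → Fin d} (hτ : Function.Involutive τ) (s t : ℝ)
    (l : Fin d) (x y : EuclideanSpace ℝ (Fin d)) :
    inner ℝ (pairScale τ s t l x) y = inner ℝ x (pairScale τ s t l y) := by
  have key : ∀ u v : EuclideanSpace ℝ (Fin d), inner ℝ u (pairScale τ s t l v) =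
      inner ℝ u v + (s - 1) * inner ℝ u (halfDiff τ v) + (t - 1) * (u l * v l) := by
    intro u v
    simp only [PiLp.inner_apply, pairScale_apply, RCLike.inner_apply, conj_trivial, add_mul,
      Finset.sum_add_distrib, ite_mul, zero_mul, Finset.sum_ite_eq', Finset.mem_univ, if_true,
      Finset.mul_sum]
    congr 1
    · congr 1
      exact Finset.sum_congr rfl fun j _ => by ring
    · ring
  rw [real_inner_comm, key, key, ← inner_halfDiff_left hτ, real_inner_comm x y,
    real_inner_comm (halfDiff τ y) x]
  ring

lemma norm_pairScale_sq {d : ℕ} {τ : Fin d → Fin d} (hτ : Function.Involutive τ) (s t : ℝ)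
    {l : Fin d} (hl : τ l = l) (x : EuclideanSpace ℝ (Fin d)) :
    ‖pairScale τ s t l x‖ ^ 2 =
      ‖x‖ ^ 2 + (s ^ 2 - 1) * ‖halfDiff τ x‖ ^ 2 + (t ^ 2 - 1) * x l ^ 2 := by
  have h := inner_self_halfDiff hτ x
  simp only [PiLp.inner_apply, RCLike.inner_apply, conj_trivial, EuclideanSpace.real_norm_sq_eq]
    at h ⊢
  have e : ∀ j, pairScale τ s t l x j ^ 2 = x j ^ 2 + (s - 1) ^ 2 * halfDiff τ x j ^ 2 +
      2 * (s - 1) * (halfDiff τ x j * x j) + if j = l then (t ^ 2 - 1) * x j ^ 2 else 0 := by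
    intro j
    rw [pairScale_apply]
    split_ifs with hj
    · subst hj; simp [hl]; ring
    · ring
  simp only [e, Finset.sum_add_distrib, ← Finset.mul_sum, Finset.sum_ite_eq', Finset.mem_univ,
    if_true]
  linear_combination (2 * (s - 1)) * h

lemma norm_le_norm_pairScale {d : ℕ} {τ : Fin d → Fin d} (hτ : Function.Involutive τ) {s t : ℝ}
    (hs : 1 ≤ s) (ht : 1 ≤ t) {l : Fin d} (hl : τ l = l) (x : EuclideanSpace ℝ (Fin d)) :
    ‖x‖ ^ 2 ≤ ‖pairScale τ s t l x‖ ^ 2 := by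
  rw [norm_pairScale_sq hτ s t hl]
  have h1 := mul_nonneg (show 0 ≤ s ^ 2 - 1 by nlinarith) (sq_nonneg ‖halfDiff τ x‖)
  have h2 := mul_nonneg (show 0 ≤ t ^ 2 - 1 by nlinarith) (sq_nonneg (x l))
  linarith

lemma norm_pairScale_le {d : ℕ} {τ : Fin d → Fin d} (hτ : Function.Involutive τ) {s t : ℝ}
    (hs : 1 ≤ s) (hst : s ≤ t) {l : Fin d} (hl : τ l = l) (x : EuclideanSpace ℝ (Fin d)) :
    ‖pairScale τ s t l x‖ ^ 2 ≤ t ^ 2 * ‖x‖ ^ 2 := by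
  -- the projection and the coordinate `l` are orthogonal to each other
  have key : ‖halfDiff τ x‖ ^ 2 + x l ^ 2 ≤ ‖x‖ ^ 2 := by
    have h := norm_sub_sq_real x (halfDiff τ x)
    rw [inner_self_halfDiff hτ] at h
    have h1 : x l ^ 2 ≤ ‖x - halfDiff τ x‖ ^ 2 := by
      rw [EuclideanSpace.real_norm_sq_eq]
      have := Finset.single_le_sum (f := fun j => (x - halfDiff τ x) j ^ 2)
        (fun j _ => sq_nonneg _) (Finset.mem_univ l)
      simpa [hl] using this
    linarith
  rw [norm_pairScale_sq hτ s t hl]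
  have h0 : s ^ 2 - 1 ≤ t ^ 2 - 1 := by nlinarith
  have h1 := mul_le_mul_of_nonneg_right h0 (sq_nonneg ‖halfDiff τ x‖)
  have h2 := mul_le_mul_of_nonneg_left key (show 0 ≤ t ^ 2 - 1 by nlinarith)
  linarith

/-- The matrix of `pairScale τ s t l`. -/
def pairMatrix {d : ℕ} (τ : Fin d → Fin d) (s t : ℝ) (l : Fin d) : Matrix (Fin d) (Fin d) ℝ :=
  Matrix.toEuclideanLin.symm (pairScale τ s t l)

@[simp] lemma toEuclideanLin_pairMatrix {d : ℕ} (τ : Fin d → Fin d) (s t : ℝ) (l : Fin d) :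
    Matrix.toEuclideanLin (pairMatrix τ s t l) = pairScale τ s t l :=
  LinearEquiv.apply_symm_apply _ _

lemma transpose_pairMatrix {d : ℕ} {τ : Fin d → Fin d} (hτ : Function.Involutive τ) (s t : ℝ)
    (l : Fin d) : (pairMatrix τ s t l).transpose = pairMatrix τ s t l := by
  apply Matrix.toEuclideanLin.injective
  rw [← Matrix.conjTranspose_eq_transpose_of_trivial,
    Matrix.toEuclideanLin_conjTranspose_eq_adjoint, toEuclideanLin_pairMatrix, eq_comm,
    LinearMap.eq_adjoint_iff]
  exact fun x y => inner_pairScale_left hτ s t l x y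

/-! ### Gossip matrices with a prescribed condition number -/

lemma hasEigenvalue_toLin'_iff {n : ℕ} (C : Matrix (Fin n) (Fin n) ℝ) (s : ℝ) :
    Module.End.HasEigenvalue (Matrix.toLin' C) s ↔ ∃ v, v ≠ 0 ∧ C.mulVec v = s • v := by
  constructor
  · intro h
    obtain ⟨v, hv⟩ := h.exists_hasEigenvector
    exact ⟨v, hv.2, by simpa using hv.apply_eq_smul⟩
  · rintro ⟨v, h0, hv⟩
    exact Module.End.hasEigenvalue_of_hasEigenvector
      ⟨Module.End.mem_eigenspace_iff.2 (by simpa using hv), h0⟩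

/-- Two copies of each vertex of `G₀`. On vectors with equal values at the two copies the matrix
acts as the Laplacian of `G₀`, and on vectors with opposite values at the two copies as the diagonal
matrix of `η`. -/
def doubledLaplacian {p : ℕ} (G₀ : SimpleGraph (Fin p)) [DecidableRel G₀.Adj] (η : Fin p → ℝ) :
    Matrix (Fin (p + p)) (Fin (p + p)) ℝ :=
  ((1 / 2 : ℝ) • Matrix.fromBlocks
    (G₀.lapMatrix ℝ + Matrix.diagonal η) (G₀.lapMatrix ℝ - Matrix.diagonal η)
    (G₀.lapMatrix ℝ - Matrix.diagonal η) (G₀.lapMatrix ℝ + Matrix.diagonal η)).submatrix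
    finSumFinEquiv.symm finSumFinEquiv.symm

/-- The vector with values `u` on the first copies of the vertices and `v` on the second ones. -/
def doubledVec {p : ℕ} (u v : Fin p → ℝ) : Fin (p + p) → ℝ :=
  Sum.elim u v ∘ finSumFinEquiv.symm

/-- The vertex of which a doubled vertex is a copy. -/
def doubledBase {p : ℕ} (i : Fin (p + p)) : Fin p := Sum.elim id id (finSumFinEquiv.symm i)

lemma exists_doubledVec {p : ℕ} (y : Fin (p + p) → ℝ) : ∃ u v, y = doubledVec u v := by
  refine ⟨y ∘ finSumFinEquiv ∘ Sum.inl, y ∘ finSumFinEquiv ∘ Sum.inr, ?_⟩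
  funext i
  obtain ⟨j, rfl⟩ := finSumFinEquiv.surjective i
  cases j <;>
    simp [doubledVec, -finSumFinEquiv_apply_left, -finSumFinEquiv_apply_right]

lemma doubledVec_injective {p : ℕ} {u v u' v' : Fin p → ℝ}
    (h : doubledVec u v = doubledVec u' v') : u = u' ∧ v = v' := by
  constructor
  · funext i
    have := congrFun h (finSumFinEquiv (Sum.inl i))
    simpa [doubledVec, -finSumFinEquiv_apply_left] using this
  · funext i
    have := congrFun h (finSumFinEquiv (Sum.inr i))
    simpa [doubledVec, -finSumFinEquiv_apply_right] using this

lemma doubledVec_dotProduct {p : ℕ} (u v u' v' : Fin p → ℝ) :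
    dotProduct (doubledVec u v) (doubledVec u' v') = dotProduct u u' + dotProduct v v' := by
  simp only [dotProduct]
  rw [← Equiv.sum_comp finSumFinEquiv, Fintype.sum_sum_type]
  simp [doubledVec, -finSumFinEquiv_apply_left, -finSumFinEquiv_apply_right]

section doubled

variable {p : ℕ} (G₀ : SimpleGraph (Fin p)) [DecidableRel G₀.Adj] (η : Fin p → ℝ)

lemma doubledLaplacian_mulVec (u v : Fin p → ℝ) :
    (doubledLaplacian G₀ η).mulVec (doubledVec u v) =
      doubledVec ((1 / 2 : ℝ) • ((G₀.lapMatrix ℝ).mulVec (u + v) + η * (u - v)))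
        ((1 / 2 : ℝ) • ((G₀.lapMatrix ℝ).mulVec (u + v) - η * (u - v))) := by
  have hd : ∀ w : Fin p → ℝ, (Matrix.diagonal η).mulVec w = η * w := by
    intro w; funext i; simp [Matrix.mulVec_diagonal]
  unfold doubledLaplacian doubledVec
  rw [Matrix.submatrix_mulVec_equiv, Matrix.smul_mulVec, Matrix.fromBlocks_mulVec]
  funext i
  obtain ⟨j, rfl⟩ := finSumFinEquiv.surjective i
  have e1 : (Sum.elim u v ∘ ⇑finSumFinEquiv.symm) ∘ ⇑finSumFinEquiv.symm.symm = Sum.elim u v := by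
    funext k; simp
  rw [e1]
  cases j <;>
    simp [-finSumFinEquiv_apply_left, -finSumFinEquiv_apply_right, Matrix.add_mulVec,
      Matrix.sub_mulVec, hd, Matrix.mulVec_add] <;> ring

lemma doubledLaplacian_posSemidef (hη : ∀ k, 0 < η k) : (doubledLaplacian G₀ η).PosSemidef := by
  apply Matrix.PosSemidef.of_dotProduct_mulVec_nonneg
  · have h0 : (G₀.lapMatrix ℝ).IsHermitian := SimpleGraph.isHermitian_lapMatrix ℝ G₀
    have h1 : (Matrix.diagonal η).IsHermitian := Matrix.isHermitian_diagonal η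
    have h2 := (Matrix.IsHermitian.fromBlocks (h0.add h1) (B := G₀.lapMatrix ℝ - Matrix.diagonal η)
      (C := G₀.lapMatrix ℝ - Matrix.diagonal η) (h0.sub h1) (h0.add h1))
    unfold doubledLaplacian
    apply Matrix.IsHermitian.submatrix
    ext i j
    have := h2.apply i j
    simp only [Matrix.conjTranspose_apply, Matrix.smul_apply, star_trivial] at this ⊢
    rw [this]
  · intro y
    obtain ⟨u, v, rfl⟩ := exists_doubledVec y
    rw [doubledLaplacian_mulVec, star_trivial, doubledVec_dotProduct]
    have h1 : 0 ≤ dotProduct (u + v) ((G₀.lapMatrix ℝ).mulVec (u + v)) := by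
      simpa using (SimpleGraph.posSemidef_lapMatrix ℝ G₀).dotProduct_mulVec_nonneg (u + v)
    have h2 : 0 ≤ dotProduct (u - v) (η * (u - v)) := by
      refine Finset.sum_nonneg fun k _ => ?_
      have := mul_nonneg (hη k).le (sq_nonneg ((u - v) k))
      simp only [Pi.mul_apply]
      linarith
    simp only [dotProduct_smul, dotProduct_add, dotProduct_sub, add_dotProduct, sub_dotProduct,
      smul_eq_mul] at h1 h2 ⊢
    linarith

lemma doubledLaplacian_kernel (hη : ∀ k, 0 < η k) (hG : G₀.Preconnected)
    (y : Fin (p + p) → ℝ) :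
    (doubledLaplacian G₀ η).mulVec y = 0 ↔ ∀ i j, y i = y j := by
  have hzero : (0 : Fin (p + p) → ℝ) = doubledVec 0 0 := by
    funext i; unfold doubledVec; rcases finSumFinEquiv.symm i <;> simp
  obtain ⟨u, v, rfl⟩ := exists_doubledVec y
  rw [doubledLaplacian_mulVec]
  constructor
  · intro h
    rw [hzero] at h
    obtain ⟨ha, hb⟩ := doubledVec_injective h
    have huv : u = v := by
      funext k
      have h1 := congrFun ha k
      have h2 := congrFun hb k
      simp only [Pi.smul_apply, Pi.add_apply, Pi.sub_apply, Pi.mul_apply, Pi.zero_apply,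
        smul_eq_mul] at h1 h2
      have h3 : η k * (u k - v k) = 0 := by linarith
      have := (mul_eq_zero.1 h3).resolve_left (hη k).ne'
      linarith
    subst huv
    have h4 : (G₀.lapMatrix ℝ).mulVec u = 0 := by
      funext k
      have h1 := congrFun ha k
      simp only [Matrix.mulVec_add, Pi.smul_apply, Pi.add_apply, Pi.zero_apply, smul_eq_mul,
        sub_self, mul_zero, add_zero] at h1 ⊢
      linarith
    rw [SimpleGraph.lapMatrix_mulVec_eq_zero_iff_forall_reachable] at h4
    intro i j
    unfold doubledVec
    simp only [Function.comp_apply]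
    rcases finSumFinEquiv.symm i with a | a <;> rcases finSumFinEquiv.symm j with b | b <;>
      exact h4 a b (hG a b)
  · intro h
    have huv : u = v := by
      funext k
      have := h (finSumFinEquiv (Sum.inl k)) (finSumFinEquiv (Sum.inr k))
      simpa [doubledVec, -finSumFinEquiv_apply_left, -finSumFinEquiv_apply_right] using this
    subst huv
    have h4 : (G₀.lapMatrix ℝ).mulVec u = 0 := by
      rw [SimpleGraph.lapMatrix_mulVec_eq_zero_iff_forall_reachable]
      intro a b _
      have := h (finSumFinEquiv (Sum.inl a)) (finSumFinEquiv (Sum.inl b))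
      simpa [doubledVec, -finSumFinEquiv_apply_left, -finSumFinEquiv_apply_right] using this
    rw [hzero, Matrix.mulVec_add, h4]
    congr 1 <;> simp

/-- A nonzero eigenvalue of the doubled Laplacian is an entry of `η`, or an eigenvalue of the
Laplacian of `G₀` with an eigenvector that sums to zero. -/
lemma doubledLaplacian_eigenvalue {s : ℝ} (hs : s ≠ 0) {y : Fin (p + p) → ℝ} (hy : y ≠ 0)
    (h : (doubledLaplacian G₀ η).mulVec y = s • y) :
    (∃ k, s = η k) ∨
      ∃ a : Fin p → ℝ, a ≠ 0 ∧ ∑ k, a k = 0 ∧ (G₀.lapMatrix ℝ).mulVec a = s • a := by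
  obtain ⟨u, v, rfl⟩ := exists_doubledVec y
  have hsm : s • doubledVec u v = doubledVec (s • u) (s • v) := by
    funext i; unfold doubledVec
    simp only [Pi.smul_apply, Function.comp_apply]
    rcases finSumFinEquiv.symm i <;> simp
  rw [doubledLaplacian_mulVec, hsm] at h
  obtain ⟨ha, hb⟩ := doubledVec_injective h
  by_cases huv : u = v
  · right
    subst huv
    have h4 : (G₀.lapMatrix ℝ).mulVec u = s • u := by
      funext k
      have h1 := congrFun ha k
      simp only [Matrix.mulVec_add, Pi.smul_apply, Pi.add_apply, smul_eq_mul, sub_self, mul_zero,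
        add_zero] at h1 ⊢
      linarith
    refine ⟨u, ?_, ?_, h4⟩
    · rintro rfl
      apply hy
      funext i; unfold doubledVec; rcases finSumFinEquiv.symm i <;> simp
    · have h5 : dotProduct (fun _ => (1 : ℝ)) ((G₀.lapMatrix ℝ).mulVec u) = 0 := by
        rw [Matrix.dotProduct_mulVec, ← Matrix.mulVec_transpose,
          SimpleGraph.isSymm_lapMatrix, SimpleGraph.lapMatrix_mulVec_const_eq_zero,
          zero_dotProduct]
      rw [h4, dotProduct_smul, smul_eq_mul] at h5
      simpa [dotProduct] using (mul_eq_zero.1 h5).resolve_left hs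
  · left
    obtain ⟨k, hk⟩ := Function.ne_iff.1 huv
    refine ⟨k, ?_⟩
    have h1 := congrFun ha k
    have h2 := congrFun hb k
    simp only [Pi.smul_apply, Pi.add_apply, Pi.sub_apply, Pi.mul_apply, smul_eq_mul] at h1 h2
    have h3 : (s - η k) * (u k - v k) = 0 := by linarith
    have := (mul_eq_zero.1 h3).resolve_right (sub_ne_zero.2 hk)
    linarith

lemma hasEigenvalue_doubledLaplacian (k : Fin p) :
    Module.End.HasEigenvalue (Matrix.toLin' (doubledLaplacian G₀ η)) (η k) := by
  rw [hasEigenvalue_toLin'_iff]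
  refine ⟨doubledVec (Pi.single k 1) (-Pi.single k 1), ?_, ?_⟩
  · intro h
    have := congrFun h (finSumFinEquiv (Sum.inl k))
    simp [doubledVec, -finSumFinEquiv_apply_left] at this
  · rw [doubledLaplacian_mulVec]
    funext i
    simp only [doubledVec, Function.comp_apply, Pi.smul_apply]
    rcases finSumFinEquiv.symm i with a | a <;> by_cases hk : a = k <;>
      simp [hk] <;> ring

lemma doubledLaplacian_apply_self (hη : ∀ k, 0 < η k) (i : Fin (p + p)) :
    doubledLaplacian G₀ η i i ≠ 0 := by
  obtain ⟨j, rfl⟩ := finSumFinEquiv.surjective i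
  have h : ∀ k, 0 < G₀.lapMatrix ℝ k k + η k := by
    intro k
    have : 0 ≤ G₀.lapMatrix ℝ k k := by simp [SimpleGraph.lapMatrix, SimpleGraph.degMatrix]
    linarith [hη k]
  rcases j with k | k <;>
    simp [doubledLaplacian, -finSumFinEquiv_apply_left, -finSumFinEquiv_apply_right, (h k).ne']

lemma doubledLaplacian_adj {i j : Fin (p + p)} (h : doubledLaplacian G₀ η i j ≠ 0) :
    doubledBase i = doubledBase j ∨ G₀.Adj (doubledBase i) (doubledBase j) := by
  by_contra! hc
  apply h
  obtain ⟨i, rfl⟩ := finSumFinEquiv.surjective i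
  obtain ⟨j, rfl⟩ := finSumFinEquiv.surjective j
  have key : ∀ a b : Fin p, a ≠ b → ¬ G₀.Adj a b → G₀.lapMatrix ℝ a b = 0 := by
    intro a b hab hn
    simp [SimpleGraph.lapMatrix, SimpleGraph.degMatrix, hab, hn]
  rcases i with a | a <;> rcases j with b | b <;>
    simp [doubledBase, -finSumFinEquiv_apply_left, -finSumFinEquiv_apply_right] at hc <;>
    simp [doubledLaplacian, -finSumFinEquiv_apply_left, -finSumFinEquiv_apply_right,
      key a b hc.1 hc.2, hc.1]

end doubled

/-- The quadratic form of the Laplacian of `G`, a sum over the edges. -/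
def lapForm {p : ℕ} (G : SimpleGraph (Fin p)) [DecidableRel G.Adj] (x : Fin p → ℝ) : ℝ :=
  (∑ i, ∑ j, if G.Adj i j then (x i - x j) ^ 2 else 0) / 2

/-- If the nonzero part of the spectrum of the Laplacian of `G₀` lies in `[lo, hi]`, then the doubled
Laplacian whose diagonal part has the entries `lo` and `hi` has condition number `hi / lo`. -/
lemma gossipConditionNumber_doubledLaplacian {p : ℕ} (G₀ : SimpleGraph (Fin p))
    [DecidableRel G₀.Adj] {η : Fin p → ℝ} {lo hi : ℝ} (hlo : 0 < lo)
    (hη : ∀ k, lo ≤ η k ∧ η k ≤ hi) {k₁ k₂ : Fin p} (h₁ : η k₁ = lo) (h₂ : η k₂ = hi)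
    (hform : ∀ x : Fin p → ℝ, lapForm G₀ x ≤ hi * ∑ k, x k ^ 2)
    (hpoin : ∀ x : Fin p → ℝ, ∑ k, x k = 0 → lo * ∑ k, x k ^ 2 ≤ lapForm G₀ x) :
    GossipConditionNumber (doubledLaplacian G₀ η) (hi / lo) := by
  have hle : lo ≤ hi := (hη k₁).1.trans (hη k₁).2
  have key : ∀ s, s ≠ 0 →
      Module.End.HasEigenvalue (Matrix.toLin' (doubledLaplacian G₀ η)) s → lo ≤ s ∧ s ≤ hi := by
    intro s hs h
    obtain ⟨y, hy, hy'⟩ := (hasEigenvalue_toLin'_iff _ _).1 h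
    rcases doubledLaplacian_eigenvalue G₀ η hs hy hy' with ⟨k, rfl⟩ | ⟨a, ha, ha0, haE⟩
    · exact hη k
    · have hpos : 0 < ∑ k, a k ^ 2 := by
        obtain ⟨k, hk⟩ := Function.ne_iff.1 ha
        exact Finset.sum_pos' (fun _ _ => sq_nonneg _)
          ⟨k, Finset.mem_univ _, by have : a k ≠ 0 := hk; positivity⟩
      have hval : lapForm G₀ a = s * ∑ k, a k ^ 2 := by
        unfold lapForm
        rw [← SimpleGraph.lapMatrix_toLinearMap₂', Matrix.toLinearMap₂'_apply', haE,
          dotProduct_smul, smul_eq_mul]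
        simp [dotProduct, sq]
      have h1 := hform a
      have h2 := hpoin a ha0
      rw [hval] at h1 h2
      exact ⟨le_of_mul_le_mul_right h2 hpos, le_of_mul_le_mul_right h1 hpos⟩
  refine ⟨hi, lo, ⟨?_, ?_⟩, ⟨⟨hlo, ?_⟩, ?_⟩, rfl⟩
  · have := hasEigenvalue_doubledLaplacian G₀ η k₂
    rwa [h₂] at this
  · intro s hs
    rcases eq_or_ne s 0 with rfl | h0
    · exact hlo.le.trans hle
    · exact (key s h0 hs).2
  · have := hasEigenvalue_doubledLaplacian G₀ η k₁
    rwa [h₁] at this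
  · rintro s ⟨hs0, hs⟩
    exact (key s hs0.ne' hs).1

/-- A connected communication graph whose gossip matrix has condition number `κ`, together with two
groups `B` and `C`, each of a third of the nodes, such that every path from `B` to `C` has length at
least `D`: the potential `φ` grows from `0` on `B` to `D` on `C`, by at most one along an edge. -/
structure SeparatedNetwork (n N D : ℕ) (κ : ℝ) where
  G : SimpleGraph (Fin n)
  W : Matrix (Fin n) (Fin n) ℝ
  gossip : IsGossipMatrix G W
  cond : GossipConditionNumber W κ
  B : Finset (Fin n)
  C : Finset (Fin n)
  φ : Fin n → ℕ
  card_B : B.card = N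
  card_C : C.card = N
  card_total : n = 3 * N
  φ_B : ∀ i ∈ B, φ i = 0
  φ_C : ∀ i ∈ C, φ i = D
  φ_le : ∀ i, φ i ≤ D
  φ_adj : ∀ i j, G.Adj i j → φ i ≤ φ j + 1
  N_pos : 0 < N
  D_pos : 0 < D

lemma card_doubledBase {p : ℕ} (s : Finset (Fin p)) :
    (Finset.univ.filter fun i : Fin (p + p) => doubledBase i ∈ s).card = 2 * s.card := by
  rw [Finset.card_filter, ← Equiv.sum_comp finSumFinEquiv, Fintype.sum_sum_type]
  simp [doubledBase, -finSumFinEquiv_apply_left, -finSumFinEquiv_apply_right]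
  ring

/-- Doubling turns a graph on `3 N` vertices with spectral bounds into a network with an exact
condition number. -/
def separatedNetworkOfLaplacian {N D : ℕ} (hN : 0 < N) (hD : 0 < D)
    (G₀ : SimpleGraph (Fin (3 * N))) [DecidableRel G₀.Adj] (hG : G₀.Preconnected)
    {lo hi : ℝ} (hlo : 0 < lo) (hle : lo ≤ hi)
    (hform : ∀ x : Fin (3 * N) → ℝ, lapForm G₀ x ≤ hi * ∑ k, x k ^ 2)
    (hpoin : ∀ x : Fin (3 * N) → ℝ, ∑ k, x k = 0 → lo * ∑ k, x k ^ 2 ≤ lapForm G₀ x)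
    (φ : ℕ → ℕ) (hB : ∀ k < N, φ k = 0) (hC : ∀ k, 2 * N ≤ k → φ k = D) (hφ : ∀ k, φ k ≤ D)
    (hadj : ∀ i j, G₀.Adj i j → φ i ≤ φ j + 1) :
    SeparatedNetwork (3 * N + 3 * N) (2 * N) D (hi / lo) :=
  let η : Fin (3 * N) → ℝ := fun k => if (k : ℕ) = 0 then lo else hi
  have hη : ∀ k, lo ≤ η k ∧ η k ≤ hi := fun k => by
    by_cases h : (k : ℕ) = 0 <;> simp [η, h, hle]
  have hpos : ∀ k, 0 < η k := fun k => hlo.trans_le (hη k).1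
  { G :=
      { Adj := fun i j => i ≠ j ∧ doubledLaplacian G₀ η i j ≠ 0
        symm := ⟨fun i j h => ⟨h.1.symm, by
          have := (doubledLaplacian_posSemidef G₀ η hpos).1.apply i j
          rw [star_trivial] at this
          rw [this]; exact h.2⟩⟩
        loopless := ⟨fun _ h => h.1 rfl⟩ }
    W := doubledLaplacian G₀ η
    gossip :=
      { posSemidef := doubledLaplacian_posSemidef G₀ η hpos
        support := fun i j => by
          by_cases h : i = j
          · subst h; simp [doubledLaplacian_apply_self G₀ η hpos i]
          · simp [h]
        kernel := doubledLaplacian_kernel G₀ η hpos hG }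
    cond := gossipConditionNumber_doubledLaplacian G₀ hlo hη
      (k₁ := ⟨0, by omega⟩) (k₂ := ⟨1, by omega⟩) (by simp [η]) (by simp [η]) hform hpoin
    B := Finset.univ.filter fun i =>
      doubledBase i ∈ Finset.univ.filter fun k : Fin (3 * N) => (k : ℕ) < N
    C := Finset.univ.filter fun i =>
      doubledBase i ∈ Finset.univ.filter fun k : Fin (3 * N) => ¬ (k : ℕ) < 2 * N
    φ := fun i => φ (doubledBase i)
    card_B := by
      rw [card_doubledBase, Fin.card_filter_val_lt]
      omega
    card_C := by
      rw [card_doubledBase, Finset.filter_not, Finset.card_sdiff_of_subset (Finset.filter_subset _ _),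
        Fin.card_filter_val_lt, Finset.card_univ, Fintype.card_fin]
      omega
    card_total := by ring
    φ_B := fun i hi => hB _ (by simpa using hi)
    φ_C := fun i hi => hC _ (by simpa using hi)
    φ_le := fun i => hφ _
    φ_adj := fun i j h => by
      rcases doubledLaplacian_adj G₀ η h.2 with h' | h'
      · rw [h']; omega
      · exact hadj _ _ h'
    N_pos := by omega
    D_pos := hD }

/-! ### Spectral bounds for the triangle and for paths -/

lemma lapForm_top_three (x : Fin (3 * 1) → ℝ) :
    lapForm (⊤ : SimpleGraph (Fin (3 * 1))) x = 3 * ∑ k, x k ^ 2 - (∑ k, x k) ^ 2 := by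
  have h3 : ∀ f : Fin (3 * 1) → ℝ, ∑ k, f k = f 0 + f 1 + f 2 := fun f => Fin.sum_univ_three f
  have e : ∀ i j : Fin (3 * 1),
      (if (⊤ : SimpleGraph (Fin (3 * 1))).Adj i j then (x i - x j) ^ 2 else 0) =
        (x i - x j) ^ 2 := by
    intro i j
    by_cases h : i = j <;> simp [h]
  simp only [lapForm, e, h3]
  ring

instance decidableRelPathGraph (p : ℕ) : DecidableRel (SimpleGraph.pathGraph p).Adj :=
  fun _ _ => decidable_of_iff' _ SimpleGraph.pathGraph_adj

lemma lapForm_pathGraph_le (p : ℕ) (x : Fin p → ℝ) :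
    lapForm (SimpleGraph.pathGraph p) x ≤ 4 * ∑ k, x k ^ 2 := by
  have hdeg : ∀ i : Fin p,
      (∑ j, if (SimpleGraph.pathGraph p).Adj i j then (1 : ℝ) else 0) ≤ 2 := by
    intro i
    rw [Finset.sum_boole]
    have : (Finset.univ.filter fun j => (SimpleGraph.pathGraph p).Adj i j).card ≤ 2 := by
      calc _ = ((Finset.univ.filter fun j => (SimpleGraph.pathGraph p).Adj i j).image
            fun j : Fin p => (j : ℕ)).card :=
            (Finset.card_image_of_injective _ Fin.val_injective).symm
        _ ≤ ({(i : ℕ) + 1, (i : ℕ) - 1} : Finset ℕ).card := by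
            apply Finset.card_le_card
            intro k hk
            simp only [Finset.mem_image, Finset.mem_filter, Finset.mem_univ, true_and,
              SimpleGraph.pathGraph_adj] at hk
            obtain ⟨j, hj, rfl⟩ := hk
            simp only [Finset.mem_insert, Finset.mem_singleton]
            omega
        _ ≤ 2 := Finset.card_le_two
    exact_mod_cast this
  have hterm : ∀ i j : Fin p,
      (if (SimpleGraph.pathGraph p).Adj i j then (x i - x j) ^ 2 else 0) ≤
        2 * ((if (SimpleGraph.pathGraph p).Adj i j then (1 : ℝ) else 0) * x i ^ 2) +
        2 * ((if (SimpleGraph.pathGraph p).Adj j i then (1 : ℝ) else 0) * x j ^ 2) := by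
    intro i j
    simp only [SimpleGraph.adj_comm _ j i]
    split_ifs
    · nlinarith [sq_nonneg (x i + x j)]
    · simp
  have hsum : ∑ i, ∑ j, (if (SimpleGraph.pathGraph p).Adj i j then (1 : ℝ) else 0) * x i ^ 2 ≤
      2 * ∑ i, x i ^ 2 := by
    rw [Finset.mul_sum]
    refine Finset.sum_le_sum fun i _ => ?_
    rw [← Finset.sum_mul]
    exact mul_le_mul_of_nonneg_right (hdeg i) (sq_nonneg _)
  have htot := Finset.sum_le_sum fun i (_ : i ∈ Finset.univ) =>
    Finset.sum_le_sum fun j (_ : j ∈ Finset.univ) => hterm i j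
  simp only [Finset.sum_add_distrib, ← Finset.mul_sum] at htot
  have hcomm : ∑ i, ∑ j, (if (SimpleGraph.pathGraph p).Adj j i then (1 : ℝ) else 0) * x j ^ 2 =
      ∑ i, ∑ j, (if (SimpleGraph.pathGraph p).Adj i j then (1 : ℝ) else 0) * x i ^ 2 :=
    Finset.sum_comm
  rw [hcomm] at htot
  unfold lapForm
  linarith

/-- The square of a difference of values along a path, by the Cauchy-Schwarz inequality. -/
lemma sq_sub_le_lapForm_pathGraph {p : ℕ} (x : Fin p → ℝ) (i j : Fin p) :
    (x i - x j) ^ 2 ≤ 2 * p * lapForm (SimpleGraph.pathGraph p) x := by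
  wlog hij : (j : ℕ) ≤ i generalizing i j
  · have := this j i (by omega)
    nlinarith
  set X : ℕ → ℝ := fun k => if h : k < p then x ⟨k, h⟩ else 0 with hX
  have hXi : ∀ i : Fin p, X i = x i := fun i => by simp [hX]
  have hstep : ∑ k ∈ Finset.range p, (if k + 1 < p then (X (k + 1) - X k) ^ 2 else 0) ≤
      2 * lapForm (SimpleGraph.pathGraph p) x := by
    rw [← Fin.sum_univ_eq_sum_range fun k => if k + 1 < p then (X (k + 1) - X k) ^ 2 else 0]
    have : 2 * lapForm (SimpleGraph.pathGraph p) x = ∑ i, ∑ j,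
        if (SimpleGraph.pathGraph p).Adj i j then (x i - x j) ^ 2 else 0 := by
      unfold lapForm; ring
    rw [this]
    refine Finset.sum_le_sum fun i _ => ?_
    have hnn : ∀ j, 0 ≤ if (SimpleGraph.pathGraph p).Adj i j then (x i - x j) ^ 2 else 0 := by
      intro j; split_ifs <;> positivity
    split_ifs with h
    · refine le_trans (le_of_eq ?_) (Finset.single_le_sum (fun j _ => hnn j)
        (Finset.mem_univ (⟨i + 1, h⟩ : Fin p)))
      rw [if_pos (SimpleGraph.pathGraph_adj.2 (Or.inl rfl)), hXi i]
      simp only [hX, dif_pos h]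
      ring
    · exact Finset.sum_nonneg fun j _ => hnn j
  have htel : x i - x j = ∑ k ∈ Finset.Ico (j : ℕ) i, (X (k + 1) - X k) := by
    rw [Finset.sum_Ico_sub _ hij, hXi, hXi]
  rw [htel]
  calc _ ≤ ((Finset.Ico (j : ℕ) i).card : ℝ) *
        ∑ k ∈ Finset.Ico (j : ℕ) i, (X (k + 1) - X k) ^ 2 := sq_sum_le_card_mul_sum_sq
    _ ≤ p * ∑ k ∈ Finset.Ico (j : ℕ) i, (X (k + 1) - X k) ^ 2 := by
        have : (Finset.Ico (j : ℕ) i).card ≤ p := by rw [Nat.card_Ico]; omega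
        have h2 : 0 ≤ ∑ k ∈ Finset.Ico (j : ℕ) i, (X (k + 1) - X k) ^ 2 :=
          Finset.sum_nonneg fun _ _ => sq_nonneg _
        gcongr
    _ ≤ p * (2 * lapForm (SimpleGraph.pathGraph p) x) := by
        gcongr
        refine le_trans ?_ hstep
        calc _ = ∑ k ∈ Finset.Ico (j : ℕ) i,
              (if k + 1 < p then (X (k + 1) - X k) ^ 2 else 0) := by
              refine Finset.sum_congr rfl fun k hk => ?_
              rw [Finset.mem_Ico] at hk
              rw [if_pos (by omega)]
          _ ≤ _ := by
              refine Finset.sum_le_sum_of_subset_of_nonneg (fun k hk => ?_) fun k _ _ => ?_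
              · rw [Finset.mem_Ico] at hk; rw [Finset.mem_range]; omega
              · split_ifs <;> positivity
    _ = _ := by ring

/-- The Poincaré inequality on a path. -/
lemma le_lapForm_pathGraph {p : ℕ} (hp : 0 < p) (x : Fin p → ℝ) (hx : ∑ k, x k = 0) :
    1 / (p : ℝ) ^ 2 * ∑ k, x k ^ 2 ≤ lapForm (SimpleGraph.pathGraph p) x := by
  have hp' : (0 : ℝ) < p := by exact_mod_cast hp
  have h1 : ∑ i : Fin p, ∑ j : Fin p, (x i - x j) ^ 2 = 2 * p * ∑ k, x k ^ 2 := by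
    have e : ∀ i j, (x i - x j) ^ 2 = x i ^ 2 - 2 * (x i * x j) + x j ^ 2 := by intros; ring
    simp only [e, Finset.sum_add_distrib, Finset.sum_sub_distrib, ← Finset.mul_sum, hx, mul_zero,
      Finset.sum_const_zero, Finset.sum_const, Finset.card_univ, Fintype.card_fin, nsmul_eq_mul]
    ring
  have h2 : ∑ i : Fin p, ∑ j : Fin p, (x i - x j) ^ 2 ≤
      p * (p * (2 * p * lapForm (SimpleGraph.pathGraph p) x)) := by
    calc _ ≤ ∑ _i : Fin p, ∑ _j : Fin p, 2 * p * lapForm (SimpleGraph.pathGraph p) x :=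
          Finset.sum_le_sum fun i _ => Finset.sum_le_sum fun j _ =>
            sq_sub_le_lapForm_pathGraph x i j
      _ = _ := by simp
  rw [h1] at h2
  rw [div_mul_eq_mul_div, one_mul, div_le_iff₀ (by positivity)]
  have h3 : (2 * p : ℝ) * ∑ k, x k ^ 2 ≤
      (2 * p) * (lapForm (SimpleGraph.pathGraph p) x * p ^ 2) := by
    linarith
  exact le_of_mul_le_mul_left h3 (by positivity)

/-- For every `κ ≥ 1` there is a network with condition number `κ` whose two groups of nodes are at
distance at least `√κ / 6`: a doubled triangle if `κ < 36`, and a doubled path otherwise. -/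
lemma exists_separatedNetwork {κ : ℝ} (hκ : 1 ≤ κ) :
    ∃ n N D : ℕ, √κ ≤ 6 * D ∧ Nonempty (SeparatedNetwork n N D κ) := by
  by_cases h36 : κ < 36
  · refine ⟨3 * 1 + 3 * 1, 2 * 1, 1, ?_, ?_⟩
    rotate_left
    · have hk : κ = 3 * κ / 3 := by ring
      rw [hk]
      refine ⟨separatedNetworkOfLaplacian (N := 1) (lo := 3) (hi := 3 * κ) one_pos one_pos
        ⊤ SimpleGraph.connected_top.preconnected (by norm_num)
        (by linarith) ?_ ?_ (fun k => min k 1) ?_ ?_ ?_ ?_⟩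
      · intro x
        rw [lapForm_top_three]
        have h1 : 0 ≤ ∑ k, x k ^ 2 := Finset.sum_nonneg fun _ _ => sq_nonneg _
        nlinarith [sq_nonneg (∑ k, x k)]
      · intro x hx
        rw [lapForm_top_three, hx]
        simp
      all_goals intros; omega
    · rw [Real.sqrt_le_left (by norm_num)]
      norm_num
      linarith
  · push Not at h36
    set N : ℕ := ⌊√κ / 6⌋₊ with hN
    have h6 : (6 : ℝ) ≤ √κ := Real.le_sqrt_of_sq_le (by norm_num; linarith)
    have hN1 : 1 ≤ N := Nat.le_floor (by push_cast; linarith)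
    have hN2 : (N : ℝ) ≤ √κ / 6 := Nat.floor_le (by positivity)
    have hN3 : √κ / 6 < N + 1 := Nat.lt_floor_add_one _
    have hN0 : (0 : ℝ) < N := by exact_mod_cast hN1
    -- the path has `3 N` vertices and spectral gap at least `1 / (3 N) ^ 2`
    have hgap : 4 / κ ≤ 1 / ((3 * N : ℕ) : ℝ) ^ 2 := by
      have hs : √κ ^ 2 = κ := Real.sq_sqrt (by linarith)
      rw [div_le_div_iff₀ (by linarith) (by push_cast; positivity)]
      push_cast
      nlinarith
    refine ⟨3 * N + 3 * N, 2 * N, N + 1, ?_, ?_⟩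
    rotate_left
    · have hk : κ = 4 / (4 / κ) := by field_simp
      rw [hk]
      refine ⟨separatedNetworkOfLaplacian (N := N) (lo := 4 / κ) (hi := 4) hN1
        (Nat.succ_pos N) (SimpleGraph.pathGraph (3 * N)) ?_ (by positivity) ?_
        (lapForm_pathGraph_le _) ?_ (fun k => min (k - (N - 1)) (N + 1)) ?_ ?_ ?_ ?_⟩
      · obtain ⟨m, hm⟩ : ∃ m, 3 * N = m + 1 := ⟨3 * N - 1, by omega⟩
        rw [hm]
        exact (SimpleGraph.pathGraph_connected m).preconnected
      · rw [div_le_iff₀ (by linarith)]; linarith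
      · intro x hx
        refine le_trans ?_ (le_lapForm_pathGraph (by omega) x hx)
        exact mul_le_mul_of_nonneg_right hgap (Finset.sum_nonneg fun _ _ => sq_nonneg _)
      · intros; omega
      · intros; omega
      · intros; omega
      · intro i j h
        rw [SimpleGraph.pathGraph_adj] at h
        omega
    · push_cast
      linarith

/-! ### What the nodes can hold in their memories -/

open Classical in
/-- `1` if `r' = r`, and `0` otherwise. -/
def roundIncrement (r r' : Round) : ℕ := if r' = r then 1 else 0

lemma Execution.count_succ {n : ℕ} {P : CoupledProblem n} {G : SimpleGraph (Fin n)}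
    (E : Execution P G) (r : Round) (k : ℕ) :
    E.count r (k + 1) = E.count r k + roundIncrement r (E.round k) := by
  have hfin : {t : ℕ | t < k ∧ E.round t = r}.Finite :=
    (Set.finite_lt_nat k).subset fun t ht => ht.1
  unfold Execution.count roundIncrement
  split_ifs with h
  · have : {t : ℕ | t < k + 1 ∧ E.round t = r} = insert k {t : ℕ | t < k ∧ E.round t = r} := by
      ext t
      simp only [Set.mem_ofPred_eq, Set.mem_insert_iff]
      constructor
      · rintro ⟨h1, h2⟩
        rcases Nat.lt_succ_iff_lt_or_eq.1 h1 with h3 | h3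
        · exact Or.inr ⟨h3, h2⟩
        · exact Or.inl h3
      · rintro (rfl | ⟨h1, h2⟩)
        · exact ⟨Nat.lt_succ_self _, h⟩
        · exact ⟨by omega, h2⟩
    rw [this, Set.ncard_insert_of_notMem (by simp) hfin]
  · congr 1
    ext t
    simp only [Set.mem_ofPred_eq]
    constructor
    · rintro ⟨h1, h2⟩
      refine ⟨lt_of_le_of_ne (Nat.lt_succ_iff.1 h1) ?_, h2⟩
      rintro rfl
      exact h h2
    · rintro ⟨h1, h2⟩
      exact ⟨by omega, h2⟩

/-- Subspaces indexed by the number `c` of rounds of type `r` contain the memories of every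
execution, if a round of type `r` leads from those with index `c` to those with index `c + 1` and
the rounds of the other types preserve them. -/
lemma Execution.memory_le {n : ℕ} {P : CoupledProblem n} {G : SimpleGraph (Fin n)}
    (E : Execution P G) (r : Round)
    (M : ∀ i : Fin n, ℕ → Submodule ℝ (EuclideanSpace ℝ (Fin (P.d i))))
    (H : Fin n → ℕ → Submodule ℝ (EuclideanSpace ℝ (Fin P.m)))
    (hM : ∀ i, Monotone (M i)) (hH : ∀ i, Monotone (H i))
    (hgrad : ∀ i c, ∀ x ∈ M i c, gradient (P.f i) x ∈ M i (c + roundIncrement r Round.gradient))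
    (hconj : ∀ i c, ∀ x ∈ M i c,
      gradient (fenchelConjugate (P.f i)) x ∈ M i (c + roundIncrement r Round.gradient))
    (hATb : ∀ i c, Matrix.toEuclideanLin (P.A i).transpose (P.b i) ∈
      M i (c + roundIncrement r Round.multiplication))
    (hAT : ∀ i c, ∀ y ∈ H i c, Matrix.toEuclideanLin (P.A i).transpose y ∈
      M i (c + roundIncrement r Round.multiplication))
    (hb : ∀ i c, P.b i ∈ H i (c + roundIncrement r Round.multiplication))
    (hA : ∀ i c, ∀ x ∈ M i c, Matrix.toEuclideanLin (P.A i) x ∈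
      H i (c + roundIncrement r Round.multiplication))
    (hcomm : ∀ i j c, G.Adj i j → H j c ≤ H i (c + roundIncrement r Round.communication)) (k : ℕ) :
    ∀ i, E.M k i ≤ M i (E.count r k) ∧ E.H k i ≤ H i (E.count r k) := by
  induction k with
  | zero => intro i; simp [E.M_zero, E.H_zero]
  | succ k ih =>
    intro i
    rw [E.count_succ]
    have hMi := (ih i).1
    have hHi := (ih i).2
    have hM' := hMi.trans (hM i (Nat.le_add_right (E.count r k) (roundIncrement r (E.round k))))
    have hH' := hHi.trans (hH i (Nat.le_add_right (E.count r k) (roundIncrement r (E.round k))))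
    rcases hr : E.round k with _ | _ | _ <;> rw [hr] at hM' hH'
    · refine ⟨(E.gradient_M k hr i).trans (Submodule.span_le.2 ?_),
        (E.gradient_H k hr i).trans hH'⟩
      rintro v ⟨x, hx, rfl | rfl | rfl⟩
      · exact hM' hx
      · exact hgrad i _ x (hMi hx)
      · exact hconj i _ x (hMi hx)
    · refine ⟨(E.multiplication_M k hr i).trans (sup_le hM' (Submodule.span_le.2 ?_)),
        (E.multiplication_H k hr i).trans (sup_le hH' (Submodule.span_le.2 ?_))⟩
      · rintro v (rfl | ⟨y, hy, rfl⟩)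
        · exact hATb i _
        · exact hAT i _ y (hHi hy)
      · rintro v (rfl | ⟨x, hx, rfl⟩)
        · exact hb i _
        · exact hA i _ x (hMi hx)
    · refine ⟨(E.communication_M k hr i).trans hM',
        (E.communication_H k hr i).trans (sup_le hH' (Submodule.span_le.2 ?_))⟩
      rintro v ⟨j, hj, hv⟩
      exact hcomm i j _ hj ((ih j).2 hv)

/-- The vectors whose coordinates in `Z` vanish. -/
def vanishing {d : ℕ} (Z : Set (Fin d)) : Submodule ℝ (EuclideanSpace ℝ (Fin d)) where
  carrier := {x | ∀ j ∈ Z, x j = 0}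
  add_mem' hx hy j hj := by simp [hx j hj, hy j hj]
  zero_mem' _ _ := rfl
  smul_mem' r x hx j hj := by simp [hx j hj]

lemma vanishing_anti {d : ℕ} {Z Z' : Set (Fin d)} (h : Z' ⊆ Z) :
    vanishing Z ≤ vanishing Z' := fun _ hx j hj => hx j (h hj)

lemma smul_add_smul_halfDiff_mem {d : ℕ} {τ : Fin d → Fin d} {Z Z' : Set (Fin d)}
    (h : ∀ j ∈ Z', j ∈ Z ∧ τ j ∈ Z) (a b : ℝ) {x : EuclideanSpace ℝ (Fin d)}
    (hx : x ∈ vanishing Z) : a • x + b • halfDiff τ x ∈ vanishing Z' := by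
  intro j hj
  simp [hx j (h j hj).1, hx _ (h j hj).2]

lemma pairScale_mem {d : ℕ} {τ : Fin d → Fin d} {Z Z' : Set (Fin d)}
    (h : ∀ j ∈ Z', j ∈ Z ∧ τ j ∈ Z) (s t : ℝ) (l : Fin d) {x : EuclideanSpace ℝ (Fin d)}
    (hx : x ∈ vanishing Z) : pairScale τ s t l x ∈ vanishing Z' := by
  intro j hj
  simp [hx j (h j hj).1, hx _ (h j hj).2]

lemma pairScale_one_mem {d : ℕ} {τ : Fin d → Fin d} {Z : Set (Fin d)} (t : ℝ) (l : Fin d)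
    {x : EuclideanSpace ℝ (Fin d)} (hx : x ∈ vanishing Z) : pairScale τ 1 t l x ∈ vanishing Z := by
  intro j hj
  simp [hx j hj]

/-! ### Problems built from involutions -/

/-- The problem in which the node `i` holds the quadratic function with Hessian `L - (L - μ) Πᵢ` and
the symmetric matrix `1 + (s - 1) Πᵢ + (t - 1) e_l e_lᵀ`, where `Πᵢ` is the projection `halfDiff`
of the involution `τ i`. -/
abbrev pairedProblem {n d : ℕ} (τ : Fin n → Fin d → Fin d) (L μ s t : ℝ) (l : Fin d)
    (b : Fin n → EuclideanSpace ℝ (Fin d)) : CoupledProblem n where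
  m := d
  d := fun _ => d
  f := fun i => pairQuad (τ i) L (μ - L)
  A := fun i => pairMatrix (τ i) s t l
  b := b

section paired

variable {n d : ℕ} {τ : Fin n → Fin d → Fin d} {L μ s t : ℝ} {l : Fin d}
  {b : Fin n → EuclideanSpace ℝ (Fin d)} {G : SimpleGraph (Fin n)}

/-- If the node `i` can learn the coordinate `j` only after `θ i j` communication rounds, then its
memory vanishes at `j` until that time. The times of two coordinates that are coupled at the node
are the same, so that only the communication spreads information. -/
lemma memory_communication (hτ : ∀ i, Function.Involutive (τ i)) (hμ : 0 < μ) (hμL : μ ≤ L)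
    (E : Execution (pairedProblem τ L μ s t l b) G) (θ : Fin n → Fin d → ℕ)
    (hθτ : ∀ i j, θ i (τ i j) = θ i j) (hθb : ∀ i j, b i j ≠ 0 → θ i j = 0)
    (hθG : ∀ i i' j, G.Adj i i' → θ i j ≤ θ i' j + 1) (k : ℕ) (i : Fin n)
    {x : EuclideanSpace ℝ (Fin d)} (hx : x ∈ E.M k i) (j : Fin d)
    (hj : E.count Round.communication k < θ i j) : x j = 0 := by
  have hb : ∀ i c, b i ∈ vanishing {j | c < θ i j} := by
    intro i c j (hj : c < θ i j)
    by_contra h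
    have := hθb i j h
    omega
  have hpair : ∀ i c, ∀ j ∈ {j | c < θ i j}, j ∈ {j | c < θ i j} ∧ τ i j ∈ {j | c < θ i j} := by
    intro i c j hj
    exact ⟨hj, by simpa [hθτ] using hj⟩
  have key := E.memory_le Round.communication (fun i c => vanishing {j | c < θ i j})
    (fun i c => vanishing {j | c < θ i j})
    (fun i c c' h => vanishing_anti fun j (hj : c' < θ i j) => lt_of_le_of_lt h hj)
    (fun i c c' h => vanishing_anti fun j (hj : c' < θ i j) => lt_of_le_of_lt h hj)
    (by
      intro i c x hx
      rw [gradient_pairQuad (hτ i)]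
      simpa [roundIncrement] using smul_add_smul_halfDiff_mem (hpair i c) _ _ hx)
    (by
      intro i c x hx
      rw [fenchelConjugate_pairQuad (hτ i) hμ hμL, gradient_pairQuad (hτ i)]
      simpa [roundIncrement] using smul_add_smul_halfDiff_mem (hpair i c) _ _ hx)
    (by
      intro i c
      rw [transpose_pairMatrix (hτ i), toEuclideanLin_pairMatrix]
      simpa [roundIncrement] using pairScale_mem (hpair i c) s t l (hb i c))
    (by
      intro i c y hy
      rw [transpose_pairMatrix (hτ i), toEuclideanLin_pairMatrix]
      simpa [roundIncrement] using pairScale_mem (hpair i c) s t l hy)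
    (fun i c => hb i _)
    (by
      intro i c x hx
      rw [toEuclideanLin_pairMatrix]
      simpa [roundIncrement] using pairScale_mem (hpair i c) s t l hx)
    (by
      intro i i' c hadj
      refine vanishing_anti fun j hj => ?_
      have := hθG i i' j hadj
      simp only [roundIncrement, if_true, Set.mem_ofPred_eq] at hj ⊢
      omega)
    k i
  exact key.1 hx j hj

/-- After `c` multiplication rounds the shared memories vanish from the coordinate `c` on, and the
private memories vanish at the coordinates that are not coupled to an earlier one. -/
lemma memory_multiplication (hτ : ∀ i, Function.Involutive (τ i)) (hμ : 0 < μ) (hμL : μ ≤ L)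
    (E : Execution (pairedProblem τ L μ s t l b) G)
    (hstep : ∀ i (j : Fin d), (j : ℕ) ≤ τ i j + 1) (hb : ∀ i j, b i j ≠ 0 → (j : ℕ) = 0)
    (k : ℕ) (i : Fin n) {x : EuclideanSpace ℝ (Fin d)} (hx : x ∈ E.M k i) (j : Fin d)
    (hj : E.count Round.multiplication k + 1 ≤ j) : x j = 0 := by
  have hb' : ∀ i c, b i ∈ vanishing {j | c + 1 ≤ (j : ℕ)} := by
    intro i c j (hj : c + 1 ≤ (j : ℕ))
    by_contra h
    have := hb i j h
    omega
  have hpair : ∀ i (c : ℕ), ∀ j ∈ {j : Fin d | c ≤ (j : ℕ) ∧ c ≤ (τ i j : ℕ)},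
      j ∈ {j : Fin d | c ≤ (j : ℕ) ∧ c ≤ (τ i j : ℕ)} ∧
        τ i j ∈ {j : Fin d | c ≤ (j : ℕ) ∧ c ≤ (τ i j : ℕ)} := by
    intro i c j hj
    refine ⟨hj, ?_⟩
    simp only [Set.mem_ofPred_eq, hτ i j] at hj ⊢
    exact hj.symm
  have key := E.memory_le Round.multiplication
    (fun i c => vanishing {j : Fin d | c ≤ (j : ℕ) ∧ c ≤ (τ i j : ℕ)})
    (fun i c => vanishing {j : Fin d | c ≤ (j : ℕ)})
    (fun i c c' h => vanishing_anti fun j hj => ⟨h.trans hj.1, h.trans hj.2⟩)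
    (fun i c c' h => vanishing_anti fun j hj => h.trans hj)
    (by
      intro i c x hx
      rw [gradient_pairQuad (hτ i)]
      simpa [roundIncrement] using smul_add_smul_halfDiff_mem (hpair i c) _ _ hx)
    (by
      intro i c x hx
      rw [fenchelConjugate_pairQuad (hτ i) hμ hμL, gradient_pairQuad (hτ i)]
      simpa [roundIncrement] using smul_add_smul_halfDiff_mem (hpair i c) _ _ hx)
    (by
      intro i c
      rw [transpose_pairMatrix (hτ i), toEuclideanLin_pairMatrix]
      simp only [roundIncrement, if_true]
      exact pairScale_mem (fun j hj => hj) s t l (hb' i c))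
    (by
      intro i c y hy
      rw [transpose_pairMatrix (hτ i), toEuclideanLin_pairMatrix]
      simp only [roundIncrement, if_true]
      refine pairScale_mem (fun j hj => ?_) s t l hy
      simp only [Set.mem_ofPred_eq] at hj ⊢
      omega)
    (by
      intro i c
      simpa [roundIncrement] using hb' i c)
    (by
      intro i c x hx
      rw [toEuclideanLin_pairMatrix]
      simp only [roundIncrement, if_true]
      refine pairScale_mem (fun j hj => ?_) s t l hx
      have := hstep i j
      simp only [Set.mem_ofPred_eq, hτ i j] at hj ⊢
      omega)
    (fun i i' c _ => le_of_eq (by simp [roundIncrement]))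
    k i
  refine key.1 hx j ?_
  have := hstep i j
  simp only [Set.mem_ofPred_eq]
  omega

/-- If the matrices are diagonal, that is if `s = 1`, then only the gradient rounds couple the
coordinates. -/
lemma memory_gradient (hτ : ∀ i, Function.Involutive (τ i)) (hμ : 0 < μ) (hμL : μ ≤ L)
    (E : Execution (pairedProblem τ L μ 1 t l b) G)
    (hstep : ∀ i (j : Fin d), (j : ℕ) ≤ τ i j + 1) (hb : ∀ i j, b i j ≠ 0 → (j : ℕ) = 0)
    (k : ℕ) (i : Fin n) {x : EuclideanSpace ℝ (Fin d)} (hx : x ∈ E.M k i) (j : Fin d)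
    (hj : E.count Round.gradient k + 1 ≤ j) : x j = 0 := by
  have hb' : ∀ i c, b i ∈ vanishing {j | c + 1 ≤ (j : ℕ)} := by
    intro i c j (hj : c + 1 ≤ (j : ℕ))
    by_contra h
    have := hb i j h
    omega
  have hpair : ∀ i (c : ℕ), ∀ j ∈ {j : Fin d | c + 1 + 1 ≤ (j : ℕ)},
      j ∈ {j : Fin d | c + 1 ≤ (j : ℕ)} ∧ τ i j ∈ {j : Fin d | c + 1 ≤ (j : ℕ)} := by
    intro i c j hj
    have := hstep i j
    simp only [Set.mem_ofPred_eq] at hj ⊢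
    omega
  have key := E.memory_le Round.gradient
    (fun i c => vanishing {j : Fin d | c + 1 ≤ (j : ℕ)})
    (fun i c => vanishing {j : Fin d | c + 1 ≤ (j : ℕ)})
    (fun i c c' h => vanishing_anti fun j hj => (Nat.succ_le_succ h).trans hj)
    (fun i c c' h => vanishing_anti fun j hj => (Nat.succ_le_succ h).trans hj)
    (by
      intro i c x hx
      rw [gradient_pairQuad (hτ i)]
      simpa [roundIncrement] using smul_add_smul_halfDiff_mem (hpair i c) _ _ hx)
    (by
      intro i c x hx
      rw [fenchelConjugate_pairQuad (hτ i) hμ hμL, gradient_pairQuad (hτ i)]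
      simpa [roundIncrement] using smul_add_smul_halfDiff_mem (hpair i c) _ _ hx)
    (by
      intro i c
      rw [transpose_pairMatrix (hτ i), toEuclideanLin_pairMatrix]
      simpa [roundIncrement] using pairScale_one_mem t l (hb' i c))
    (by
      intro i c y hy
      rw [transpose_pairMatrix (hτ i), toEuclideanLin_pairMatrix]
      simpa [roundIncrement] using pairScale_one_mem t l hy)
    (by
      intro i c
      simpa [roundIncrement] using hb' i c)
    (by
      intro i c x hx
      rw [toEuclideanLin_pairMatrix]
      simpa [roundIncrement] using pairScale_one_mem t l hx)
    (fun i i' c _ => le_of_eq (by simp [roundIncrement]))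
    k i
  exact key.1 hx j hj

/-- The matrices `Aᵢ Aᵢᵀ` lie between `1` and `t²`; the value `t²` is taken at the coordinate `l`,
and the value `1` by all of them at a coordinate `l'` that no involution moves. -/
lemma constraintConditionNumber_pairedProblem (hτ : ∀ i, Function.Involutive (τ i)) (hn : 0 < n)
    (hs : 1 ≤ s) (hst : s ≤ t) {l' : Fin d} (hll' : l' ≠ l) (hl : ∀ i, τ i l = l)
    (hl' : ∀ i, τ i l' = l') :
    (pairedProblem τ L μ s t l b).ConstraintConditionNumber (t ^ 2) := by
  have hn' : (n : ℝ) ≠ 0 := by exact_mod_cast hn.ne'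
  have hmv : ∀ i (v : Fin d → ℝ),
      (pairMatrix (τ i) s t l * (pairMatrix (τ i) s t l).transpose).mulVec v =
        WithLp.ofLp (pairScale (τ i) s t l (pairScale (τ i) s t l (WithLp.toLp 2 v))) := by
    intro i v
    rw [transpose_pairMatrix (hτ i), ← Matrix.mulVec_mulVec]
    simp only [← toEuclideanLin_pairMatrix]
    rfl
  have hS : ∀ v : Fin d → ℝ, (pairedProblem τ L μ s t l b).S.mulVec v = (1 / (n : ℝ)) •
      ∑ i, WithLp.ofLp (pairScale (τ i) s t l (pairScale (τ i) s t l (WithLp.toLp 2 v))) := by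
    intro v
    unfold CoupledProblem.S
    rw [Matrix.smul_mulVec, Matrix.sum_mulVec]
    simp only [hmv]
  have hself : ∀ i (x : EuclideanSpace ℝ (Fin d)),
      dotProduct (WithLp.ofLp x) (WithLp.ofLp (pairScale (τ i) s t l (pairScale (τ i) s t l x))) =
        ‖pairScale (τ i) s t l x‖ ^ 2 := by
    intro i x
    rw [← real_inner_self_eq_norm_sq, inner_pairScale_left (hτ i), real_inner_comm,
      EuclideanSpace.inner_eq_star_dotProduct, star_trivial, dotProduct_comm]
  have hnorm : ∀ v : Fin d → ℝ, dotProduct v v = ‖WithLp.toLp 2 v‖ ^ 2 := by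
    intro v
    rw [EuclideanSpace.real_norm_sq_eq]
    simp [dotProduct, sq]
  have hvpos : ∀ v : Fin d → ℝ, v ≠ 0 → 0 < ‖WithLp.toLp 2 v‖ ^ 2 := by
    intro v hv
    have : WithLp.toLp 2 v ≠ 0 := by simpa using hv
    positivity
  have hfix : ∀ i j, j ≠ l → τ i j ≠ l := by
    intro i j hj h
    rw [← hl i] at h
    exact hj ((hτ i).injective h)
  have hsingle : ∀ i (k : Fin d), τ i k = k → ∀ j, Pi.single (M := fun _ => ℝ) k 1 (τ i j) =
      Pi.single (M := fun _ => ℝ) k 1 j := by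
    intro i k hk j
    have : τ i j = k ↔ j = k := by
      rw [← (hτ i).injective.eq_iff, hτ i j, hk]
    by_cases h : j = k
    · rw [h, hk]
    · rw [Pi.single_eq_of_ne h, Pi.single_eq_of_ne (this.not.2 h)]
  refine ⟨t ^ 2, 1, ⟨?_, ?_⟩, ⟨⟨one_pos, ?_⟩, ?_⟩, by simp⟩
  · refine ⟨⟨0, hn⟩, ?_⟩
    rw [hasEigenvalue_toLin'_iff]
    refine ⟨Pi.single l 1, by simp, ?_⟩
    rw [hmv]
    funext j
    simp only [pairScale_apply, halfDiff_apply, hsingle _ l (hl _), sub_self]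
    by_cases h : j = l
    · simp [h, hl, sq]
      ring
    · simp [h]
  · rintro r ⟨i, hr⟩
    obtain ⟨v, hv, hE⟩ := (hasEigenvalue_toLin'_iff _ _).1 hr
    have h1 := hself i (WithLp.toLp 2 v)
    rw [← hmv i v, hE] at h1
    simp only [dotProduct_smul, smul_eq_mul] at h1
    rw [hnorm] at h1
    have h2 := norm_pairScale_le (hτ i) hs hst (hl i) (WithLp.toLp 2 v)
    rw [← h1] at h2
    exact le_of_mul_le_mul_right h2 (hvpos v hv)
  · rw [hasEigenvalue_toLin'_iff]
    refine ⟨Pi.single l' 1, by simp, ?_⟩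
    rw [hS]
    have e : ∀ i, WithLp.ofLp (pairScale (τ i) s t l (pairScale (τ i) s t l
        (WithLp.toLp 2 (Pi.single l' 1)))) = Pi.single l' 1 := by
      intro i
      funext j
      simp only [pairScale_apply, halfDiff_apply, hsingle _ l' (hl' _), sub_self]
      by_cases h : j = l
      · simp [h, hll'.symm, hl]
      · simp [h, hfix i j h]
    simp only [e]
    rw [Finset.sum_const, Finset.card_univ, Fintype.card_fin, ← Nat.cast_smul_eq_nsmul ℝ, smul_smul]
    congr 1
    field_simp
  · rintro r ⟨-, hr⟩
    obtain ⟨v, hv, hE⟩ := (hasEigenvalue_toLin'_iff _ _).1 hr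
    have h1 : dotProduct v ((pairedProblem τ L μ s t l b).S.mulVec v) =
        (1 / (n : ℝ)) * ∑ i, ‖pairScale (τ i) s t l (WithLp.toLp 2 v)‖ ^ 2 := by
      rw [hS, dotProduct_smul, dotProduct_sum, smul_eq_mul]
      simp only [← hself]
    rw [hE, dotProduct_smul, smul_eq_mul, hnorm] at h1
    have h2 : ∑ _i : Fin n, ‖WithLp.toLp 2 v‖ ^ 2 ≤
        ∑ i, ‖pairScale (τ i) s t l (WithLp.toLp 2 v)‖ ^ 2 :=
      Finset.sum_le_sum fun i _ => norm_le_norm_pairScale (hτ i) hs (hs.trans hst) (hl i) _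
    rw [Finset.sum_const, Finset.card_univ, Fintype.card_fin, nsmul_eq_mul] at h2
    have h3 : 1 * ‖WithLp.toLp 2 v‖ ^ 2 ≤ r * ‖WithLp.toLp 2 v‖ ^ 2 := by
      rw [h1, one_mul, one_div, ← div_eq_inv_mul, le_div_iff₀ (by positivity)]
      linarith
    exact le_of_mul_le_mul_right h3 (hvpos v hv)

/-- A feasible point whose gradients are `Aᵢᵀ z` for a multiplier `z` is a solution. -/
lemma isSolution_pairedProblem (hτ : ∀ i, Function.Involutive (τ i)) (hμ : 0 ≤ μ) (hμL : μ ≤ L)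
    (x : Fin n → EuclideanSpace ℝ (Fin d)) (z : EuclideanSpace ℝ (Fin d))
    (hx : ∑ i, (pairScale (τ i) s t l (x i) - b i) = 0)
    (hz : ∀ i, L • x i + (μ - L) • halfDiff (τ i) (x i) = pairScale (τ i) s t l z) :
    (pairedProblem τ L μ s t l b).IsSolution x := by
  refine ⟨by simpa [CoupledProblem.Feasible] using hx, fun y hy => ?_⟩
  have hy' : ∑ i, (pairScale (τ i) s t l (y i) - b i) = 0 := by
    simpa [CoupledProblem.Feasible] using hy
  have h1 : ∀ i, inner ℝ z (pairScale (τ i) s t l (y i)) - inner ℝ z (pairScale (τ i) s t l (x i)) ≤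
      pairQuad (τ i) L (μ - L) (y i) - pairQuad (τ i) L (μ - L) (x i) := by
    intro i
    have h2 := pairQuad_eq (hτ i) L (μ - L) (x i) (y i)
    have h3 := le_pairQuad (hτ i) (a := L) (b := μ - L) (by linarith) (y i - x i)
    have h4 : 0 ≤ (L + (μ - L)) / 2 * ‖y i - x i‖ ^ 2 := by
      have : 0 ≤ L + (μ - L) := by linarith
      positivity
    rw [hz i, inner_pairScale_left (hτ i), map_sub, inner_sub_right] at h2
    linarith
  have h5 := Finset.sum_le_sum fun i (_ : i ∈ Finset.univ) => h1 i
  simp only [Finset.sum_sub_distrib, ← inner_sum] at h5 hx hy'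
  rw [sub_eq_zero.1 hx, sub_eq_zero.1 hy', sub_self] at h5
  exact sub_nonneg.1 h5

end paired

/-! ### The chain of coordinates and its geometric multiplier -/

/-- The involution of `{0, …, T + 1}` that exchanges `j` and `j + 1` for the `j` of the same parity
as `r`, as long as `j + 1 < T`, and fixes the other indices. -/
def chainPartner (r T : ℕ) (j : Fin (T + 2)) : Fin (T + 2) :=
  ⟨if (j + r) % 2 = 0 then (if (j : ℕ) + 1 < T then j + 1 else j)
    else if 0 < (j : ℕ) ∧ (j : ℕ) < T then j - 1 else j, by split_ifs <;> omega⟩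

lemma val_chainPartner (r T : ℕ) (j : Fin (T + 2)) :
    (chainPartner r T j : ℕ) = if (j + r) % 2 = 0 then (if (j : ℕ) + 1 < T then j + 1 else j : ℕ)
      else if 0 < (j : ℕ) ∧ (j : ℕ) < T then j - 1 else j := rfl

lemma chainPartner_involutive (r T : ℕ) : Function.Involutive (chainPartner r T) := by
  intro j
  apply Fin.ext
  rw [val_chainPartner, val_chainPartner]
  split_ifs <;> omega

lemma chainPartner_of_le {r T : ℕ} {j : Fin (T + 2)} (h : T ≤ j) : chainPartner r T j = j := by
  apply Fin.ext
  rw [val_chainPartner]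
  split_ifs <;> omega

/-- The vector with coordinates `q ^ j + q ^ (2 T - 1 - j)` for `j < T`: a geometric sequence and
its reflection about `T - 1/2`, which makes it an exact solution of the recurrence at the free end
of the chain. -/
def reflectedGeom (q : ℝ) (T : ℕ) : EuclideanSpace ℝ (Fin (T + 2)) :=
  WithLp.toLp 2 fun j => if (j : ℕ) < T then q ^ (j : ℕ) + q ^ (2 * T - 1 - j) else 0

lemma reflectedGeom_apply (q : ℝ) (T : ℕ) (j : Fin (T + 2)) :
    reflectedGeom q T j = if (j : ℕ) < T then q ^ (j : ℕ) + q ^ (2 * T - 1 - j) else 0 := rfl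

lemma le_reflectedGeom {q : ℝ} (hq : 0 < q) {T : ℕ} {j : Fin (T + 2)} (hj : (j : ℕ) < T) :
    q ^ (j : ℕ) ≤ reflectedGeom q T j := by
  rw [reflectedGeom_apply, if_pos hj]
  have : 0 < q ^ (2 * T - 1 - (j : ℕ)) := by positivity
  linarith

/-- A bound on the norm that does not depend on the length of the chain. -/
lemma norm_reflectedGeom_sq_le {q : ℝ} (hq : 0 < q) (hq1 : q < 1) (T : ℕ) :
    ‖reflectedGeom q T‖ ^ 2 ≤ 4 / (1 - q) := by
  rw [EuclideanSpace.real_norm_sq_eq]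
  have hterm : ∀ j : Fin (T + 2), reflectedGeom q T j ^ 2 ≤ 4 * q ^ (j : ℕ) := by
    intro j
    rw [reflectedGeom_apply]
    split_ifs with h
    · have h1 : q ^ (2 * T - 1 - (j : ℕ)) ≤ q ^ (j : ℕ) :=
        pow_le_pow_of_le_one hq.le hq1.le (by omega)
      have h2 : 0 < q ^ (2 * T - 1 - (j : ℕ)) := by positivity
      have h3 : q ^ (j : ℕ) ≤ 1 := pow_le_one₀ hq.le hq1.le
      have h4 : 0 < q ^ (j : ℕ) := by positivity
      nlinarith
    · have : 0 < q ^ (j : ℕ) := by positivity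
      linarith
  refine (Finset.sum_le_sum fun j _ => hterm j).trans ?_
  rw [← Finset.mul_sum, Fin.sum_univ_eq_sum_range (fun j => q ^ j), le_div_iff₀ (by linarith),
    mul_assoc, geom_sum_mul_neg]
  have : 0 < q ^ (T + 2) := by positivity
  linarith

/-- Off the first coordinate the reflected geometric vector is an eigenvector of the sum of the two
projections, which is half the Laplacian of the chain. -/
lemma halfDiff_add_halfDiff_reflectedGeom {q a : ℝ} (hqa : q ^ 2 + 1 = (2 + a) * q) (T : ℕ)
    {j : Fin (T + 2)} (hj : 0 < (j : ℕ)) :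
    halfDiff (chainPartner 1 T) (reflectedGeom q T) j +
      halfDiff (chainPartner 0 T) (reflectedGeom q T) j = -(a / 2) * reflectedGeom q T j := by
  rcases le_or_gt T (j : ℕ) with hT | hT
  · simp [chainPartner_of_le hT, reflectedGeom_apply, hT.not_gt]
  · obtain ⟨j, hjT⟩ := j
    obtain ⟨i, rfl⟩ : ∃ i, j = i + 1 := ⟨j - 1, by simp only at hj; omega⟩
    simp only at hj hT
    set ζ : ℕ → ℝ := fun k => q ^ k + q ^ (2 * T - 1 - k) with hζ
    have hrec : ζ i + ζ (i + 2) = (2 + a) * ζ (i + 1) := by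
      obtain ⟨e, he⟩ : ∃ e, 2 * T - 1 - i = e + 2 := ⟨2 * T - 1 - i - 2, by omega⟩
      have e1 : 2 * T - 1 - (i + 1) = e + 1 := by omega
      have e2 : 2 * T - 1 - (i + 2) = e := by omega
      simp only [hζ, he, e1, e2]
      linear_combination (q ^ i + q ^ e) * hqa
    have hval : ∀ k : Fin (T + 2), (k : ℕ) < T → reflectedGeom q T k = ζ k := by
      intro k hk
      rw [reflectedGeom_apply, if_pos hk]
    have hend : ¬ i + 1 + 1 < T → ζ (i + 1) = ζ (i + 2) := by
      intro h
      have e1 : T = i + 2 := by omega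
      have e2 : 2 * T - 1 - (i + 1) = i + 2 := by omega
      have e3 : 2 * T - 1 - (i + 2) = i + 1 := by omega
      simp only [hζ, e2, e3]
      ring
    -- one involution moves `i + 1` down, and the other one moves it up or reflects it
    have hpart : ∀ r, ((i + 1 + r) % 2 = 0 →
        reflectedGeom q T (chainPartner r T ⟨i + 1, hjT⟩) = ζ (i + 2)) ∧
        (¬ (i + 1 + r) % 2 = 0 →
          reflectedGeom q T (chainPartner r T ⟨i + 1, hjT⟩) = ζ i) := by
      intro r
      have hv := val_chainPartner r T ⟨i + 1, hjT⟩
      simp only at hv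
      constructor
      · intro h
        rw [if_pos h] at hv
        by_cases h2 : i + 1 + 1 < T
        · rw [if_pos h2] at hv
          rw [hval _ (by omega), hv]
        · rw [if_neg h2] at hv
          rw [hval _ (by omega), hv, hend h2]
      · intro h
        rw [if_neg h, if_pos (by omega)] at hv
        rw [hval _ (by omega), hv]
        simp
    simp only [halfDiff_apply]
    rw [hval ⟨i + 1, hjT⟩ hT]
    rcases Nat.mod_two_eq_zero_or_one i with h | h
    · rw [(hpart 1).1 (by omega), (hpart 0).2 (by omega)]
      simp only
      linear_combination (-1 / 2) * hrec
    · rw [(hpart 1).2 (by omega), (hpart 0).1 (by omega)]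
      simp only
      linear_combination (-1 / 2) * hrec

/-- The ratio of the geometric sequence: the root of `(1 - q)² = a q` in `(0, 1)`. -/
lemma exists_chain_ratio {a : ℝ} (ha : 0 < a) :
    ∃ q : ℝ, 0 < q ∧ q < 1 ∧ q ^ 2 + 1 = (2 + a) * q ∧ -Real.log q ≤ 2 * √a := by
  have h1 : √a ^ 2 = a := Real.sq_sqrt ha.le
  have h2 : √(a + 4) ^ 2 = a + 4 := Real.sq_sqrt (by linarith)
  have h3 : 0 < √a := Real.sqrt_pos.2 ha
  have h4 : √a < √(a + 4) := Real.sqrt_lt_sqrt ha.le (by linarith)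
  have h5 : √(a + 4) < √a + 2 := by
    rw [Real.sqrt_lt' (by linarith)]
    nlinarith
  -- the square root of the ratio
  set u : ℝ := (√(a + 4) - √a) / 2 with hu
  have hu0 : 0 < u := by rw [hu]; linarith
  have hu1 : u < 1 := by rw [hu]; linarith
  have hequ : 1 - u ^ 2 = √a * u := by rw [hu]; linear_combination (-1 / 4) * h2 + (1 / 4) * h1
  refine ⟨u ^ 2, by positivity, by nlinarith, ?_, ?_⟩
  · have : (1 - u ^ 2) ^ 2 = a * u ^ 2 := by rw [hequ, mul_pow, h1]
    linear_combination this
  · have h6 : u⁻¹ ≤ 1 + √a := by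
      rw [inv_le_iff_one_le_mul₀ hu0]
      nlinarith
    have h7 := Real.log_le_sub_one_of_pos (inv_pos.2 hu0)
    rw [Real.log_inv] at h7
    rw [Real.log_pow]
    push_cast
    linarith

/-! ### The hard instances -/

section instances

variable {n N D : ℕ} {κW : ℝ} (net : SeparatedNetwork n N D κW)

open Classical in
/-- The nodes of `B` couple the coordinates `(1, 2), (3, 4), …`, those of `C` couple
`(0, 1), (2, 3), …`, and the other nodes couple nothing. -/
def chainInvolution (T : ℕ) (i : Fin n) : Fin (T + 2) → Fin (T + 2) :=
  if i ∈ net.B then chainPartner 1 T else if i ∈ net.C then chainPartner 0 T else id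

lemma chainInvolution_B {T : ℕ} {i : Fin n} (h : i ∈ net.B) :
    chainInvolution net T i = chainPartner 1 T := by
  simp [chainInvolution, h]

lemma SeparatedNetwork.notMem_B {i : Fin n} (h : i ∈ net.C) : i ∉ net.B := by
  intro hB
  have h1 := net.φ_B i hB
  have h2 := net.φ_C i h
  have := net.D_pos
  omega

lemma chainInvolution_C {T : ℕ} {i : Fin n} (h : i ∈ net.C) :
    chainInvolution net T i = chainPartner 0 T := by
  simp [chainInvolution, h, net.notMem_B h]

lemma chainInvolution_of_notMem {T : ℕ} {i : Fin n} (hB : i ∉ net.B) (hC : i ∉ net.C) :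
    chainInvolution net T i = id := by
  simp [chainInvolution, hB, hC]

/-- Reduction of a statement about `chainInvolution` to its three values. -/
lemma chainInvolution_cases (T : ℕ) (i : Fin n) :
    (i ∈ net.B ∧ chainInvolution net T i = chainPartner 1 T) ∨
    (i ∈ net.C ∧ chainInvolution net T i = chainPartner 0 T) ∨
    chainInvolution net T i = id := by
  by_cases hB : i ∈ net.B
  · exact Or.inl ⟨hB, chainInvolution_B net hB⟩
  by_cases hC : i ∈ net.C
  · exact Or.inr (Or.inl ⟨hC, chainInvolution_C net hC⟩)
  exact Or.inr (Or.inr (chainInvolution_of_notMem net hB hC))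

lemma chainInvolution_involutive (T : ℕ) (i : Fin n) :
    Function.Involutive (chainInvolution net T i) := by
  rcases chainInvolution_cases net T i with ⟨-, h⟩ | ⟨-, h⟩ | h <;> rw [h]
  · exact chainPartner_involutive 1 T
  · exact chainPartner_involutive 0 T
  · exact fun _ => rfl

lemma chainInvolution_of_le {T : ℕ} (i : Fin n) {j : Fin (T + 2)} (hj : T ≤ j) :
    chainInvolution net T i j = j := by
  rcases chainInvolution_cases net T i with ⟨-, h⟩ | ⟨-, h⟩ | h <;> rw [h]
  · exact chainPartner_of_le hj
  · exact chainPartner_of_le hj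
  · rfl

lemma le_chainInvolution_add_one {T : ℕ} (i : Fin n) (j : Fin (T + 2)) :
    (j : ℕ) ≤ chainInvolution net T i j + 1 := by
  have key : ∀ r, (j : ℕ) ≤ chainPartner r T j + 1 := by
    intro r
    rw [val_chainPartner]
    split_ifs <;> omega
  rcases chainInvolution_cases net T i with ⟨-, h⟩ | ⟨-, h⟩ | h <;> rw [h]
  · exact key 1
  · exact key 0
  · exact Nat.le_succ _

/-- A node outside the two groups. -/
lemma SeparatedNetwork.exists_notMem : ∃ i, i ∉ net.B ∧ i ∉ net.C := by
  classical
  by_contra! h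
  have h1 : (Finset.univ : Finset (Fin n)) ⊆ net.B ∪ net.C := by
    intro i _
    by_cases hB : i ∈ net.B
    · exact Finset.mem_union_left _ hB
    · exact Finset.mem_union_right _ (h i hB)
  have h2 := (Finset.card_le_card h1).trans (Finset.card_union_le _ _)
  rw [net.card_B, net.card_C, Finset.card_univ, Fintype.card_fin] at h2
  have := net.card_total
  have := net.N_pos
  omega

lemma sum_halfDiff_chainInvolution (T : ℕ) (z : EuclideanSpace ℝ (Fin (T + 2)))
    (j : Fin (T + 2)) :
    ∑ i, halfDiff (chainInvolution net T i) z j =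
      N * (halfDiff (chainPartner 1 T) z j + halfDiff (chainPartner 0 T) z j) := by
  classical
  have h : ∀ i, halfDiff (chainInvolution net T i) z j =
      (if i ∈ net.B then halfDiff (chainPartner 1 T) z j else 0) +
        (if i ∈ net.C then halfDiff (chainPartner 0 T) z j else 0) := by
    intro i
    by_cases hB : i ∈ net.B
    · have hC : i ∉ net.C := fun hC => net.notMem_B hC hB
      simp [chainInvolution_B net hB, hB, hC]
    by_cases hC : i ∈ net.C
    · simp [chainInvolution_C net hC, hB, hC]
    · simp [chainInvolution_of_notMem net hB hC, hB, hC]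
  simp only [h, Finset.sum_add_distrib, Finset.sum_ite_mem, Finset.univ_inter, Finset.sum_const,
    net.card_B, net.card_C, nsmul_eq_mul]
  ring

/-- The point of the node with involution `τ` that corresponds to the multiplier `z`: the gradient
there is `Aᵀ z`. -/
def primalPoint {d : ℕ} (τ : Fin d → Fin d) (L μ s : ℝ) (z : EuclideanSpace ℝ (Fin d)) :
    EuclideanSpace ℝ (Fin d) := (1 / L) • z + (s / μ - 1 / L) • halfDiff τ z

lemma norm_primalPoint_sq_le {d : ℕ} {τ : Fin d → Fin d} (hτ : Function.Involutive τ)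
    {L μ s : ℝ} (hμ : 0 < μ) (hμL : μ ≤ L) (hs : 1 ≤ s) (z : EuclideanSpace ℝ (Fin d)) :
    ‖primalPoint τ L μ s z‖ ^ 2 ≤ (s / μ) ^ 2 * ‖z‖ ^ 2 := by
  have hL : 0 < L := hμ.trans_le hμL
  have h1 : 0 ≤ s / μ - 1 / L := sub_nonneg.2 (div_le_div₀ (by linarith) hs hμ hμL)
  have h2 : ‖halfDiff τ z‖ ≤ ‖z‖ := abs_le_of_sq_le_sq' (norm_halfDiff_sq_le hτ z) (norm_nonneg _)
    |>.2
  have h3 : ‖primalPoint τ L μ s z‖ ≤ (s / μ) * ‖z‖ := by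
    refine (norm_add_le _ _).trans ?_
    rw [norm_smul, norm_smul, Real.norm_of_nonneg h1, Real.norm_of_nonneg (by positivity)]
    nlinarith
  rw [← mul_pow]
  gcongr

lemma gradient_primalPoint {d : ℕ} {τ : Fin d → Fin d} (hτ : Function.Involutive τ)
    {L μ s : ℝ} (hμ : μ ≠ 0) (hL : L ≠ 0) (t : ℝ) {l : Fin d}
    {z : EuclideanSpace ℝ (Fin d)} (hz : z l = 0) :
    L • primalPoint τ L μ s z + (μ - L) • halfDiff τ (primalPoint τ L μ s z) =
      pairScale τ s t l z := by
  ext j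
  have h : (if j = l then (t - 1) * z j else 0) = 0 := by
    split_ifs with h
    · rw [h, hz, mul_zero]
    · rfl
  simp only [pairScale_apply, h]
  simp [primalPoint, hτ j]
  field_simp
  ring

lemma pairScale_primalPoint {d : ℕ} {τ : Fin d → Fin d} (hτ : Function.Involutive τ)
    {L μ s t : ℝ} {l : Fin d} (hl : τ l = l) {z : EuclideanSpace ℝ (Fin d)} (hz : z l = 0)
    (j : Fin d) :
    pairScale τ s t l (primalPoint τ L μ s z) j =
      1 / L * z j + (s ^ 2 / μ - 1 / L) * halfDiff τ z j := by
  have h : (if j = l then (t - 1) * primalPoint τ L μ s z j else 0) = 0 := by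
    split_ifs with h
    · simp [h, primalPoint, hl, hz]
    · rfl
  rw [pairScale_apply, h]
  simp [primalPoint, hτ j]
  ring

/-- The problems on the chains of length `T`. Their solutions have a geometric tail whose constant
`K` does not depend on `T`, so that a point which vanishes at the coordinate `p` is far away. -/
lemma exists_chain_instance {L μ s t q : ℝ} (hμ : 0 < μ) (hμL : μ < L) (hs : 1 ≤ s) (hst : s ≤ t)
    (hq : 0 < q) (hq1 : q < 1)
    (hqa : q ^ 2 + 1 = (2 + 6 / (s ^ 2 * (L / μ) - 1)) * q) :
    ∃ K : ℝ, 0 < K ∧ ∀ T : ℕ, 0 < T →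
      ∃ (b xs : Fin n → EuclideanSpace ℝ (Fin (T + 2))),
        IsInstance (pairedProblem (chainInvolution net T) L μ s t (Fin.last _) b) xs L μ (t ^ 2) ∧
        (∀ i j, b i j ≠ 0 → i ∈ net.B ∧ (j : ℕ) = 0) ∧
        ∀ x : Fin n → EuclideanSpace ℝ (Fin (T + 2)), ∀ p : Fin (T + 2), (p : ℕ) < T →
          (∀ i, x i p = 0) → K * q ^ (2 * (p : ℕ)) ≤ ∑ i, ‖x i - xs i‖ ^ 2 := by
  have hL : 0 < L := hμ.trans hμL
  have hN : (0 : ℝ) < N := by exact_mod_cast net.N_pos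
  have hnN : (n : ℝ) = 3 * N := by exact_mod_cast net.card_total
  have hn : 0 < n := by have := net.card_total; have := net.N_pos; omega
  have hχ : 0 < s ^ 2 * (L / μ) - 1 := by
    have h1 : 1 < L / μ := (one_lt_div hμ).2 hμL
    have h2 : 1 ≤ s ^ 2 := one_le_pow₀ hs
    nlinarith
  obtain ⟨m, hmB, hmC⟩ := net.exists_notMem
  set R₀ : ℝ := n * ((s / μ) ^ 2 * (4 / (1 - q))) with hR₀
  have hR₀pos : 0 < R₀ := by
    have h1 : 0 < 1 - q := by linarith
    have h2 : (0 : ℝ) < n := by exact_mod_cast hn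
    positivity
  refine ⟨1 / R₀ * (1 / L) ^ 2, by positivity, fun T hT => ?_⟩
  set τ := chainInvolution net T with hτdef
  have hτ : ∀ i, Function.Involutive (τ i) := chainInvolution_involutive net T
  set l : Fin (T + 2) := Fin.last (T + 1) with hl
  have hlT : T ≤ (l : ℕ) := by simp [hl]
  set z := reflectedGeom q T with hz
  have hzl : z l = 0 := by rw [hz, reflectedGeom_apply, if_neg (by omega)]
  -- the unscaled solution
  set y : Fin n → EuclideanSpace ℝ (Fin (T + 2)) := fun i => primalPoint (τ i) L μ s z with hy
  have hym : y m = (1 / L) • z := by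
    simp only [hy, hτdef, chainInvolution_of_notMem net hmB hmC, primalPoint]
    ext j
    simp
  set R : ℝ := ∑ i, ‖y i‖ ^ 2 with hR
  have hRle : R ≤ R₀ := by
    have : ∀ i ∈ Finset.univ, ‖y i‖ ^ 2 ≤ (s / μ) ^ 2 * (4 / (1 - q)) := fun i _ =>
      (norm_primalPoint_sq_le (hτ i) hμ hμL.le hs z).trans
        (mul_le_mul_of_nonneg_left (norm_reflectedGeom_sq_le hq hq1 T) (sq_nonneg _))
    refine (Finset.sum_le_sum this).trans (le_of_eq ?_)
    simp [hR₀]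
  have hRpos : 0 < R := by
    refine Finset.sum_pos' (fun _ _ => sq_nonneg _) ⟨m, Finset.mem_univ _, ?_⟩
    have h0 : z ⟨0, by omega⟩ ≠ 0 := by
      have := le_reflectedGeom hq (j := (⟨0, by omega⟩ : Fin (T + 2))) hT
      simp only [pow_zero] at this
      rw [hz]
      linarith
    have h1 : y m ≠ 0 := by
      intro h
      apply h0
      have := congrArg (fun v : EuclideanSpace ℝ (Fin (T + 2)) => v ⟨0, by omega⟩) (hym.symm.trans h)
      simpa [hL.ne'] using this
    positivity
  set ρ : ℝ := 1 / √R with hρ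
  have hρ2 : ρ ^ 2 = 1 / R := by rw [hρ, div_pow, Real.sq_sqrt hRpos.le, one_pow]
  set w : EuclideanSpace ℝ (Fin (T + 2)) := ∑ i, pairScale (τ i) s t l (ρ • y i) with hw
  have hwj : ∀ j : Fin (T + 2), 0 < (j : ℕ) → w j = 0 := by
    intro j hj
    have h1 : w j = ρ * ∑ i, pairScale (τ i) s t l (y i) j := by
      rw [hw, Finset.mul_sum]
      simp only [map_smul]
      simp [WithLp.ofLp_sum, Finset.sum_apply]
    have h2 : ∑ i, pairScale (τ i) s t l (y i) j = 0 := by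
      simp only [hy]
      rw [Finset.sum_congr rfl fun i _ =>
        pairScale_primalPoint (hτ i) (chainInvolution_of_le net i hlT) hzl j,
        Finset.sum_add_distrib, ← Finset.mul_sum, ← Finset.mul_sum,
        sum_halfDiff_chainInvolution net T z j,
        halfDiff_add_halfDiff_reflectedGeom hqa T hj, Finset.sum_const, Finset.card_univ,
        Fintype.card_fin, nsmul_eq_mul, hnN]
      have h3 : s ^ 2 / μ - 1 / L = (s ^ 2 * (L / μ) - 1) / L := by field_simp
      rw [h3, ← hz]
      generalize s ^ 2 * (L / μ) - 1 = χ at hχ ⊢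
      field_simp
      ring
    rw [h1, h2, mul_zero]
  classical
  refine ⟨fun i => if i ∈ net.B then (1 / (N : ℝ)) • w else 0, fun i => ρ • y i,
    ⟨fun i => smoothStronglyConvex_pairQuad (hτ i) hμL.le, ?_, ?_, ?_⟩, ?_, ?_⟩
  · refine constraintConditionNumber_pairedProblem hτ hn hs hst (l' := ⟨T, by omega⟩) ?_
      (fun i => chainInvolution_of_le net i hlT) (fun i => chainInvolution_of_le net i le_rfl)
    intro h
    have := congrArg Fin.val h
    simp [hl] at this
  · refine isSolution_pairedProblem hτ hμ.le hμL.le _ (ρ • z) ?_ ?_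
    · rw [Finset.sum_sub_distrib, ← hw, Finset.sum_ite_mem, Finset.univ_inter, Finset.sum_const,
        net.card_B, ← Nat.cast_smul_eq_nsmul ℝ, smul_smul, mul_one_div_cancel hN.ne', one_smul,
        sub_self]
    · intro i
      have := gradient_primalPoint (s := s) (hτ i) hμ.ne' hL.ne' t hzl
      rw [map_smul, map_smul, ← this, smul_add, smul_comm L ρ, smul_comm (μ - L) ρ]
  · simp only [norm_smul, mul_pow, Real.norm_eq_abs, sq_abs]
    rw [← Finset.mul_sum, hρ2, ← hR]
    field_simp
  · intro i j hij
    by_cases hB : i ∈ net.B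
    · refine ⟨hB, ?_⟩
      by_contra h
      simp [hB, hwj j (Nat.pos_of_ne_zero h)] at hij
    · simp [hB] at hij
  · intro x p hp hx
    have h1 : ‖x m - ρ • y m‖ ^ 2 ≤ ∑ i, ‖x i - ρ • y i‖ ^ 2 :=
      Finset.single_le_sum (f := fun i => ‖x i - ρ • y i‖ ^ 2) (fun _ _ => sq_nonneg _)
        (Finset.mem_univ m)
    have h2 : (x m - ρ • y m) p ^ 2 ≤ ‖x m - ρ • y m‖ ^ 2 := by
      rw [EuclideanSpace.real_norm_sq_eq]
      exact Finset.single_le_sum (f := fun j => (x m - ρ • y m) j ^ 2) (fun _ _ => sq_nonneg _)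
        (Finset.mem_univ p)
    have h3 : (x m - ρ • y m) p ^ 2 = 1 / R * (1 / L) ^ 2 * z p ^ 2 := by
      rw [← hρ2]
      simp [hx m, hym]
      ring
    have h4 : q ^ (2 * (p : ℕ)) ≤ z p ^ 2 := by
      rw [mul_comm, pow_mul]
      exact pow_le_pow_left₀ (by positivity) (le_reflectedGeom hq hp) 2
    have h5 : 1 / R₀ ≤ 1 / R := one_div_le_one_div_of_le hRpos hRle
    have h6 : 1 / R₀ * (1 / L) ^ 2 * q ^ (2 * (p : ℕ)) ≤ 1 / R * (1 / L) ^ 2 * z p ^ 2 :=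
      mul_le_mul (mul_le_mul_of_nonneg_right h5 (sq_nonneg _)) h4 (pow_nonneg hq.le _)
        (mul_nonneg (one_div_pos.2 hRpos).le (sq_nonneg _))
    exact h6.trans (h3.symm.le.trans (h2.trans h1))

end instances

/-! ### From the geometric tail to the number of rounds -/

/-- If the error is at least `K q ^ (2 p)` as long as the coordinate `p < T` is unknown, then
accuracy `ε` needs `p` of order `log (1 / ε) / √a`. The threshold for `ε` absorbs the constant `K`,
and `T` is taken so large that the truncation of the chain is not seen at the accuracy `εmin`. -/
lemma exists_threshold {q a K : ℝ} (ha : 0 < a) (hq : 0 < q) (hq1 : q < 1)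
    (hlog : -Real.log q ≤ 2 * √a) (hK : 0 < K) :
    ∃ εmax : ℝ, 0 < εmax ∧ εmax ≤ 1 ∧ ∀ εmin : ℝ, 0 < εmin → ∃ T : ℕ, 0 < T ∧
      ∀ ε : ℝ, εmin ≤ ε → ε ≤ εmax → ∀ p : ℕ, (p < T → K * q ^ (2 * p) ≤ ε) →
        Real.log (1 / ε) / (8 * √a) + 2 ≤ p := by
  have hsa : 0 < √a := Real.sqrt_pos.2 ha
  refine ⟨min 1 (Real.exp (-(2 * (8 * √a - Real.log K)))), lt_min one_pos (Real.exp_pos _),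
    min_le_left _ _, fun εmin hεmin => ?_⟩
  obtain ⟨T, hT⟩ := exists_pow_lt_of_lt_one (div_pos hεmin hK) hq1
  rw [lt_div_iff₀ hK] at hT
  refine ⟨T + 1, Nat.succ_pos T, fun ε h1 h2 p hp => ?_⟩
  have hε : 0 < ε := hεmin.trans_le h1
  have hKp : K * q ^ (2 * p) ≤ ε := by
    rcases Nat.lt_or_ge p (T + 1) with h | h
    · exact hp h
    · have : q ^ (2 * p) ≤ q ^ T := pow_le_pow_of_le_one hq.le hq1.le (by omega)
      nlinarith
  have h3 := Real.log_le_log (by positivity) hKp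
  rw [Real.log_mul hK.ne' (by positivity), Real.log_pow] at h3
  push_cast at h3
  have h4 : Real.log ε ≤ -(2 * (8 * √a - Real.log K)) := by
    rw [Real.log_le_iff_le_exp hε]
    exact h2.trans (min_le_right _ _)
  have h5 : (p : ℝ) * (-Real.log q) ≤ p * (2 * √a) :=
    mul_le_mul_of_nonneg_left hlog (Nat.cast_nonneg p)
  rw [one_div, Real.log_inv, ← le_sub_iff_add_le, div_le_iff₀ (by positivity)]
  nlinarith

/-- On the hard instance the coordinates `p` at which the memories still vanish when accuracy `ε` is
reached are of order at least `log (1 / ε)`. The coupling of the coordinates is of relative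
strength `s² κ - 1`, with `κ = L / μ`. -/
lemma exists_hard_problem {n N D : ℕ} {κW : ℝ} (net : SeparatedNetwork n N D κW) {L μ s t : ℝ}
    (hμ : 0 < μ) (hμL : μ < L) (hs : 1 ≤ s) (hst : s ≤ t) :
    ∃ εmax : ℝ, 0 < εmax ∧ εmax ≤ 1 ∧ ∀ εmin : ℝ, 0 < εmin →
      ∃ (T : ℕ) (b xs : Fin n → EuclideanSpace ℝ (Fin (T + 2))),
        IsInstance (pairedProblem (chainInvolution net T) L μ s t (Fin.last _) b) xs L μ (t ^ 2) ∧
        (∀ i j, b i j ≠ 0 → i ∈ net.B ∧ (j : ℕ) = 0) ∧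
        ∀ ε : ℝ, εmin ≤ ε → ε ≤ εmax →
          ∀ (E : Execution (pairedProblem (chainInvolution net T) L μ s t (Fin.last _) b) net.G)
            (k : ℕ), E.Reaches xs ε k → ∀ p : ℕ,
            (∀ i, ∀ x ∈ E.M k i, ∀ j : Fin (T + 2), (j : ℕ) = p → x j = 0) →
            Real.log (1 / ε) / (8 * √(6 / (s ^ 2 * (L / μ) - 1))) + 2 ≤ p := by
  have hχ : 0 < s ^ 2 * (L / μ) - 1 := by
    have h1 : 1 < L / μ := (one_lt_div hμ).2 hμL
    have h2 : 1 ≤ s ^ 2 := one_le_pow₀ hs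
    nlinarith
  have ha : 0 < 6 / (s ^ 2 * (L / μ) - 1) := by positivity
  obtain ⟨q, hq, hq1, hqa, hlog⟩ := exists_chain_ratio ha
  obtain ⟨K, hK, hinst⟩ := exists_chain_instance net hμ hμL hs hst hq hq1 hqa
  obtain ⟨εmax, h0, h1, hthr⟩ := exists_threshold ha hq hq1 hlog hK
  refine ⟨εmax, h0, h1, fun εmin hεmin => ?_⟩
  obtain ⟨T, hT, hrate⟩ := hthr εmin hεmin
  obtain ⟨b, xs, hI, hb, hfar⟩ := hinst T hT
  refine ⟨T, b, xs, hI, hb, fun ε hε hε' E k hE p hp => ?_⟩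
  obtain ⟨x, hxM, hx⟩ := hE
  refine hrate ε hε hε' p fun hpT => ?_
  exact (hfar x ⟨p, by omega⟩ hpT fun i => hp i (x i) (hxM i) _ rfl).trans hx

/-- The number of communication rounds after which the node `i` can know the coordinate `j`: the
information has to cross the distance `D` between the groups `j` times before the coordinate `j`
appears, in `B` if `j` is even and in `C` if `j` is odd, and then it has to reach the node. -/
def arrivalTime {n N D : ℕ} {κW : ℝ} (net : SeparatedNetwork n N D κW) (i : Fin n) (j : ℕ) : ℕ :=
  j * D + if j % 2 = 0 then net.φ i else D - net.φ i

lemma arrivalTime_chainInvolution {n N D : ℕ} {κW : ℝ} (net : SeparatedNetwork n N D κW) (T : ℕ)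
    (i : Fin n) (j : Fin (T + 2)) :
    arrivalTime net i (chainInvolution net T i j) = arrivalTime net i j := by
  have hmul : ∀ a : ℕ, (a + 1) * D = a * D + D := fun a => by ring
  have key : ∀ r : ℕ, (∀ a : ℕ, (a + r) % 2 = 0 → arrivalTime net i a = arrivalTime net i (a + 1)) →
      arrivalTime net i (chainPartner r T j) = arrivalTime net i j := by
    intro r h
    rw [val_chainPartner]
    split_ifs with h1 h2 h3
    · exact (h j h1).symm
    · rfl
    · have := h (j - 1) (by omega)
      rwa [Nat.sub_add_cancel h3.1] at this
    · rfl
  rcases chainInvolution_cases net T i with ⟨hB, h⟩ | ⟨hC, h⟩ | h <;> rw [h]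
  · refine key 1 fun a ha => ?_
    simp only [arrivalTime, net.φ_B i hB]
    rw [if_neg (by omega), if_pos (by omega), hmul]
    omega
  · refine key 0 fun a ha => ?_
    simp only [arrivalTime, net.φ_C i hC]
    rw [if_pos (by omega), if_neg (by omega), hmul]
    omega
  · rfl

lemma arrivalTime_le_of_adj {n N D : ℕ} {κW : ℝ} (net : SeparatedNetwork n N D κW)
    {i i' : Fin n} (h : net.G.Adj i i') (j : ℕ) :
    arrivalTime net i j ≤ arrivalTime net i' j + 1 := by
  have h1 := net.φ_adj i i' h
  have h2 := net.φ_adj i' i h.symm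
  unfold arrivalTime
  split_ifs <;> omega

/-- The constant of the theorem: `6` comes from the distance of the groups, `8` from the logarithm
of the ratio of the chain, and the root from `s² κ - 1 ≥ (1 - 1 / κ₀) s² κ`. -/
def lowerConstant (κ₀ : ℝ) : ℝ := √((1 - 1 / κ₀) / 6) / 48

lemma lowerConstant_pos {κ₀ : ℝ} (hκ₀ : 1 < κ₀) : 0 < lowerConstant κ₀ := by
  have : 1 / κ₀ < 1 := (div_lt_one (by linarith)).2 hκ₀
  have : 0 < (1 - 1 / κ₀) / 6 := by linarith
  exact div_pos (Real.sqrt_pos.2 this) (by norm_num)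

lemma lowerConstant_mul_le {κ₀ κ s Λ : ℝ} (hκ₀ : 1 < κ₀) (hκ : κ₀ ≤ κ) (hs : 1 ≤ s) (hΛ : 0 ≤ Λ) :
    6 * lowerConstant κ₀ * (√κ * s * Λ) ≤ Λ / (8 * √(6 / (s ^ 2 * κ - 1))) := by
  have hs2 : 1 ≤ s ^ 2 := one_le_pow₀ hs
  have hχ : 0 < s ^ 2 * κ - 1 := by nlinarith
  have h0 : 1 / κ₀ < 1 := (div_lt_one (by linarith)).2 hκ₀
  have h1 : (1 - 1 / κ₀) / 6 * (s ^ 2 * κ) ≤ (s ^ 2 * κ - 1) / 6 := by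
    have h2 : κ₀ ≤ s ^ 2 * κ := by nlinarith
    have h3 : 1 ≤ 1 / κ₀ * (s ^ 2 * κ) := by
      rw [one_div, ← div_eq_inv_mul, le_div_iff₀ (by linarith)]
      linarith
    linarith
  have h2 : √((1 - 1 / κ₀) / 6) * (√κ * s) ≤ √((s ^ 2 * κ - 1) / 6) := by
    refine le_trans (le_of_eq ?_) (Real.sqrt_le_sqrt h1)
    rw [Real.sqrt_mul (by linarith), Real.sqrt_mul (by positivity), Real.sqrt_sq (by linarith)]
    ring
  have h3 : 1 / √(6 / (s ^ 2 * κ - 1)) = √((s ^ 2 * κ - 1) / 6) := by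
    rw [one_div, ← Real.sqrt_inv, inv_div]
  calc 6 * lowerConstant κ₀ * (√κ * s * Λ) = √((1 - 1 / κ₀) / 6) * (√κ * s) * (Λ / 8) := by
        unfold lowerConstant; ring
    _ ≤ √((s ^ 2 * κ - 1) / 6) * (Λ / 8) := by gcongr
    _ = _ := by rw [← h3]; field_simp

end

theorem theorem2 (κ₀ : ℝ) (hκ₀ : 1 < κ₀) :
    ∃ c : ℝ, 0 < c ∧
      ∀ L μ κA κW : ℝ, 0 < μ → κ₀ ≤ L / μ → 1 ≤ κA → 1 ≤ κW →
        -- matrix multiplications and communication rounds, on the same instance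
        (∃ (n : ℕ) (G : SimpleGraph (Fin n)) (W : Matrix (Fin n) (Fin n) ℝ),
          IsGossipMatrix G W ∧ GossipConditionNumber W κW ∧
          ∃ εmax : ℝ, 0 < εmax ∧ ∀ εmin : ℝ, 0 < εmin →
            ∃ (P : CoupledProblem n) (xs : P.Point), IsInstance P xs L μ κA ∧
              ∀ ε : ℝ, εmin ≤ ε → ε ≤ εmax →
                RequiresRounds P G xs ε Round.multiplication
                  (c * (√(L / μ) * √κA * Real.log (1 / ε))) ∧
                RequiresRounds P G xs ε Round.communication
                  (c * (√(L / μ) * √κA * √κW * Real.log (1 / ε)))) ∧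
        -- gradient computations, on another instance
        (∃ (n : ℕ) (G : SimpleGraph (Fin n)) (W : Matrix (Fin n) (Fin n) ℝ),
          IsGossipMatrix G W ∧ GossipConditionNumber W κW ∧
          ∃ εmax : ℝ, 0 < εmax ∧ ∀ εmin : ℝ, 0 < εmin →
            ∃ (P : CoupledProblem n) (xs : P.Point), IsInstance P xs L μ κA ∧
              ∀ ε : ℝ, εmin ≤ ε → ε ≤ εmax →
                RequiresRounds P G xs ε Round.gradient
                  (c * (√(L / μ) * Real.log (1 / ε)))) := by
  refine ⟨lowerConstant κ₀, lowerConstant_pos hκ₀, fun L μ κA κW hμ hκ hκA hκW => ?_⟩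
  have hμL : μ < L := (one_lt_div hμ).1 (hκ₀.trans_le hκ)
  have ht : 1 ≤ √κA := Real.one_le_sqrt.2 hκA
  have ht2 : √κA ^ 2 = κA := Real.sq_sqrt (by linarith)
  have hc := lowerConstant_pos hκ₀
  obtain ⟨n, N, D, hD, ⟨net⟩⟩ := exists_separatedNetwork hκW
  have hlogε : ∀ εmin εmax ε : ℝ, 0 < εmin → εmax ≤ 1 → εmin ≤ ε → ε ≤ εmax →
      0 ≤ Real.log (1 / ε) := by
    intro εmin εmax ε h1 h2 h3 h4
    exact Real.log_nonneg (by rw [le_div_iff₀ (by linarith)]; linarith)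
  refine ⟨⟨n, net.G, net.W, net.gossip, net.cond, ?_⟩, ⟨n, net.G, net.W, net.gossip, net.cond, ?_⟩⟩
  · obtain ⟨εmax, h0, h1, h⟩ := exists_hard_problem net hμ hμL ht le_rfl
    refine ⟨εmax, h0, fun εmin hεmin => ?_⟩
    obtain ⟨T, b, xs, hI, hb, hrounds⟩ := h εmin hεmin
    rw [ht2] at hI
    refine ⟨pairedProblem (chainInvolution net T) L μ (√κA) (√κA) (Fin.last _) b, xs, hI,
      fun ε hε hε' => ?_⟩
    have hΛ := hlogε εmin εmax ε hεmin h1 hε hε'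
    have hbound := lowerConstant_mul_le hκ₀ hκ ht hΛ
    have hτ := chainInvolution_involutive net T
    have hnn : 0 ≤ lowerConstant κ₀ * (√(L / μ) * √κA * Real.log (1 / ε)) := by positivity
    constructor
    · intro E k hE
      have := hrounds ε hε hε' E k hE (E.count Round.multiplication k + 1) fun i x hx j hj =>
        memory_multiplication hτ hμ hμL.le E (le_chainInvolution_add_one net)
          (fun i j h => (hb i j h).2) k i hx j hj.ge
      push_cast at this
      linarith
    · intro E k hE
      set c := E.count Round.communication k with hcdef
      have h3 := hrounds ε hε hε' E k hE (c / D + 1) fun i x hx j hj => by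
        refine memory_communication hτ hμ hμL.le E (fun i j => arrivalTime net i j)
          (arrivalTime_chainInvolution net T) (fun i j h => ?_)
          (fun i i' j h => arrivalTime_le_of_adj net h j) k i hx j ?_
        · simp [arrivalTime, (hb i j h).2, net.φ_B i (hb i j h).1]
        · refine lt_of_lt_of_le ?_ (Nat.le_add_right _ _)
          rw [hj, ← hcdef, mul_comm]
          exact Nat.lt_mul_div_succ c net.D_pos
      have h4 : ((c / D : ℕ) : ℝ) * D ≤ c := by exact_mod_cast Nat.div_mul_le_self c D
      push_cast at h3
      have h5 : 6 * (lowerConstant κ₀ * (√(L / μ) * √κA * Real.log (1 / ε))) ≤ ((c / D : ℕ) : ℝ) := by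
        linarith
      calc lowerConstant κ₀ * (√(L / μ) * √κA * √κW * Real.log (1 / ε)) =
            lowerConstant κ₀ * (√(L / μ) * √κA * Real.log (1 / ε)) * √κW := by ring
        _ ≤ lowerConstant κ₀ * (√(L / μ) * √κA * Real.log (1 / ε)) * (6 * D) :=
            mul_le_mul_of_nonneg_left hD hnn
        _ = 6 * (lowerConstant κ₀ * (√(L / μ) * √κA * Real.log (1 / ε))) * D := by ring
        _ ≤ ((c / D : ℕ) : ℝ) * D := mul_le_mul_of_nonneg_right h5 (Nat.cast_nonneg D)
        _ ≤ c := h4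
  · obtain ⟨εmax, h0, h1, h⟩ := exists_hard_problem net hμ hμL le_rfl ht
    refine ⟨εmax, h0, fun εmin hεmin => ?_⟩
    obtain ⟨T, b, xs, hI, hb, hrounds⟩ := h εmin hεmin
    rw [ht2] at hI
    refine ⟨pairedProblem (chainInvolution net T) L μ 1 (√κA) (Fin.last _) b, xs, hI,
      fun ε hε hε' E k hE => ?_⟩
    have hΛ := hlogε εmin εmax ε hεmin h1 hε hε'
    have hbound := lowerConstant_mul_le hκ₀ hκ le_rfl hΛ
    have hnn : 0 ≤ lowerConstant κ₀ * (√(L / μ) * Real.log (1 / ε)) := by positivity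
    have := hrounds ε hε hε' E k hE (E.count Round.gradient k + 1) fun i x hx j hj =>
      memory_gradient (chainInvolution_involutive net T) hμ hμL.le E
        (le_chainInvolution_add_one net) (fun i j h => (hb i j h).2) k i hx j hj.ge
    push_cast at this
    rw [mul_one] at hbound
    linarith
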